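/- **Theorem.** Let $0<p,q<1$, let $\theta\in[0,1)$ be irrational and let $N\ge 1$ be an integer. All algebras are unital complex $*$-algebras, and in all of them $x^{-n}:=(x^*)^n$ for $n\in\mathbb N$. Let $\mathcal O(S^3_{pq\theta})$ be the universal $*$-algebra generated by $a,b$ with relations $$ab=e^{2\pi i\theta}ba,\quad ab^*=e^{-2\pi i\theta}b^*a,\quad a^*a-p\,aa^*=1-p,\quad b^*b-q\,bb^*=1-q,\quad (1-aa^*)(1-bb^*)=0.$$ Let $\mathcal O(\mathbb Z/N)$ be the $*$-algebra generated by a unitary $u$ with $u^N=1$, let $\rho:\mathcal O(S^3_{pq\theta})\to\mathcal O(S^3_{pq\theta})\otimes\mathcal O(\mathbb Z/N)$ be the $*$-homomorphism with $\rho(a)=a\otimes u$, $\rho(b)=b\otimes u$, and let $\mathcal O(L^N_{pq\theta})=\{x:\rho(x)=x\otimes 1\}$ (equivalently, the span of the elements of degree divisible by $N$, where $\deg a=\deg b=1$). For $s>0$ and $n\ge1$ put $\mathsf Q^s_n(Y)=\sum_{m=1}^n(-1)^m s^{-nm+m(m+1)/2}\binom{n}{m}_{s}Y^m$, where $\binom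 nm_s=\frac{[n]_s!}{[m]_s!\,[n-m]_s!}$, $[n]_s!=[1]_s\cdots[n]_s$, $[n]_s=1+s+\dots+s^{n-1}$, and put $Q^s_n=\mathsf Q^s_n$, $Q^s_0=0$ and $Q^s_{-n}(Y)=\mathsf Q^{s^{-1}}_{n}(sY)$. Let $\mathcal A$ be the universal $*$-algebra generated by $\tilde a,\tilde b,z,A,B$ with the relations $$A^*=A,\quad B^*=B,\quad AB=0,\quad Az=pzA,\quad zB=qBz,\quad z^*z=1-pA-B,\quad zz^*=1-A-qB,$$ $$A\tilde a=p^N\tilde aA,\quad A\tilde b=\tilde bA,\quad B\tilde a=\tilde aB,\quad B\tilde b=q^N\tilde bB,\quad z\tilde a=e^{2\pi iN\theta}\tilde az,\quad z\tilde b^*=e^{-2\pi iN\theta}\tilde b^*z,$$ $$z\tilde a^*-e^{-2\pi iN\theta}\tilde a^*z=e^{-\pi iN(N+1)\theta}(p^N-1)Az^{1-N}\tilde b^*,$$ $$z\tilde b-e^{2\pi iN\theta}\tilde bz=e^{\pi i\theta N(N-1)}q(q^{-N}-1)Bz^{1-N}\tilde a,$$ $$\tilde a\tilde b=e^{2\pi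 iN^2\theta}\tilde b\tilde a,\quad \tilde a\tilde b^*=e^{-2\pi iN^2\theta}\tilde b^*\tilde a,\quad \tilde a\tilde b^*=e^{-\pi i\theta N(N-1)}z^N,$$ $$\tilde a^*\tilde a=1+Q^p_{-N}(A),\quad \tilde a\tilde a^*=1+Q^p_N(A),\quad \tilde b^*\tilde b=1+Q^q_{-N}(B),\quad \tilde b\tilde b^*=1+Q^q_N(B).$$ Then $\mathcal A$ and $\mathcal O(L^N_{pq\theta})$ are isomorphic as $*$-algebras, through a $*$-isomorphism with $\tilde a\mapsto a^N$, $\tilde b\mapsto b^N$, $z\mapsto ab^*$, $A\mapsto 1-aa^*$, $B\mapsto 1-bb^*$. Moreover the vectors $$A^kz^\mu\tilde b^\nu\ (k>0,\ \mu,\nu\in\mathbb Z),\qquad B^kz^\mu\tilde a^\nu\ (k\ge0,\ \mu,\nu\in\mathbb Z)$$ are pairwise distinct and form a linear basis of $\mathcal A$. -/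

import Mathlib

open scoped TensorProduct

noncomputable section

namespace HeegaardLens

/-! ### Free complex *-algebras -/

/-- The free unital complex *-algebra on `X`: noncommutative polynomials in the letters
`x` (`Sum.inl x`) and their formal adjoints `x*` (`Sum.inr x`). -/
def FreeStarAlgebra (X : Type) : Type := FreeAlgebra ℂ (X ⊕ X)

namespace FreeStarAlgebra

variable {X : Type}

instance : Ring (FreeStarAlgebra X) := inferInstanceAs (Ring (FreeAlgebra ℂ (X ⊕ X)))

instance : Algebra ℂ (FreeStarAlgebra X) := inferInstanceAs (Algebra ℂ (FreeAlgebra ℂ (X ⊕ X)))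

/-- The letters `x` and `x*` as elements of the free *-algebra. -/
def letter (y : X ⊕ X) : FreeStarAlgebra X := FreeAlgebra.ι ℂ y

/-- The generator `x`. -/
def gen (x : X) : FreeStarAlgebra X := letter (Sum.inl x)

/-- The opposite of the free algebra, with `ℂ` acting through complex conjugation. -/
@[reducible] def conjOpAlgebra (X : Type) : Algebra ℂ (FreeStarAlgebra X)ᵐᵒᵖ :=
  RingHom.toAlgebra' ((algebraMap ℂ (FreeStarAlgebra X)ᵐᵒᵖ).comp (starRingEnd ℂ))
    (fun c x => Algebra.commutes (starRingEnd ℂ c) x)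

/-- The conjugate-linear anti-multiplicative map exchanging `x` and `x*`. -/
def starAux (X : Type) : FreeStarAlgebra X →+* (FreeStarAlgebra X)ᵐᵒᵖ :=
  letI := conjOpAlgebra X
  (FreeAlgebra.lift ℂ (A := (FreeStarAlgebra X)ᵐᵒᵖ)
    (fun y : X ⊕ X => MulOpposite.op (letter y.swap))).toRingHom

theorem starAux_letter (y : X ⊕ X) :
    starAux X (letter y) = MulOpposite.op (letter y.swap) :=
  letI := conjOpAlgebra X
  FreeAlgebra.lift_ι_apply (R := ℂ) (A := (FreeStarAlgebra X)ᵐᵒᵖ) _ y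

theorem starAux_algebraMap (c : ℂ) :
    starAux X (algebraMap ℂ (FreeStarAlgebra X) c) =
      MulOpposite.op (algebraMap ℂ (FreeStarAlgebra X) (starRingEnd ℂ c)) :=
  letI := conjOpAlgebra X
  AlgHom.commutes (FreeAlgebra.lift ℂ (A := (FreeStarAlgebra X)ᵐᵒᵖ)
    (fun y : X ⊕ X => MulOpposite.op (letter y.swap))) c

theorem induction {P : FreeStarAlgebra X → Prop}
    (scalar : ∀ c : ℂ, P (algebraMap ℂ _ c)) (letter : ∀ y : X ⊕ X, P (letter y))
    (mul : ∀ a b, P a → P b → P (a * b)) (add : ∀ a b, P a → P b → P (a + b))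
    (a : FreeStarAlgebra X) : P a :=
  FreeAlgebra.induction ℂ (X ⊕ X) (motive := P) scalar letter mul add a

instance : StarRing (FreeStarAlgebra X) where
  star x := (starAux X x).unop
  star_involutive x := by
    show (starAux X (starAux X x).unop).unop = x
    induction x using FreeStarAlgebra.induction with
    | scalar c => simp [starAux_algebraMap]
    | letter y => simp [starAux_letter]
    | mul a b ha hb => simp [ha, hb]
    | add a b ha hb => simp [ha, hb]
  star_mul a b := by simp
  star_add a b := by simp

theorem star_letter (y : X ⊕ X) : star (letter y) = letter y.swap := by
  show (starAux X (letter y)).unop = _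
  rw [starAux_letter, MulOpposite.unop_op]

theorem star_algebraMap (c : ℂ) :
    star (algebraMap ℂ (FreeStarAlgebra X) c) = algebraMap ℂ _ (starRingEnd ℂ c) := by
  show (starAux X _).unop = _
  rw [starAux_algebraMap, MulOpposite.unop_op]

instance : StarModule ℂ (FreeStarAlgebra X) where
  star_smul c a := by
    rw [Algebra.smul_def, star_mul, star_algebraMap, Algebra.smul_def]
    exact (Algebra.commutes _ _).symm

variable {R : Type*} [Ring R] [StarRing R] [Algebra ℂ R]

/-- The algebra map underlying `lift`. -/
def liftAux (f : X → R) : FreeStarAlgebra X →ₐ[ℂ] R :=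
  FreeAlgebra.lift ℂ (Sum.elim f (fun x => star (f x)))

theorem liftAux_letter (f : X → R) (y : X ⊕ X) :
    liftAux f (letter y) = Sum.elim f (fun x => star (f x)) y :=
  FreeAlgebra.lift_ι_apply _ _

/-- The *-homomorphism with prescribed values on the generators. -/
def lift [StarModule ℂ R] (f : X → R) : FreeStarAlgebra X →⋆ₐ[ℂ] R :=
  { liftAux f with
    map_star' := fun a => by
      show liftAux f (star a) = star (liftAux f a)
      induction a using FreeStarAlgebra.induction with
      | scalar c =>
        rw [star_algebraMap, AlgHom.commutes, AlgHom.commutes]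
        exact algebraMap_star_comm c
      | letter y =>
        rw [star_letter, liftAux_letter, liftAux_letter]
        cases y <;> simp
      | mul a b ha hb => simp [ha, hb]
      | add a b ha hb => simp [ha, hb] }

theorem lift_gen [StarModule ℂ R] (f : X → R) (x : X) : lift f (gen x) = f x :=
  liftAux_letter f (Sum.inl x)

end FreeStarAlgebra

/-! ### Universal *-algebras given by generators and relations -/

/-- The relations `r` together with their adjoints. -/
inductive StarClosure {F : Type*} [Star F] (r : F → F → Prop) : F → F → Prop
  | of {x y : F} : r x y → StarClosure r x y
  | star {x y : F} : r x y → StarClosure r (star x) (star y)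

theorem StarClosure.star_rel {F : Type*} [InvolutiveStar F] (r : F → F → Prop) (x y : F)
    (h : StarClosure r x y) : StarClosure r (Star.star x) (Star.star y) := by
  cases h with
  | of h => exact .star h
  | star h => simpa using StarClosure.of h

/-- The universal unital complex *-algebra generated by `X` subject to the relations `r`: the
quotient of the free *-algebra by the *-ideal generated by the `x - y` with `r x y`. -/
def UniversalStarAlgebra (X : Type) (r : FreeStarAlgebra X → FreeStarAlgebra X → Prop) : Type :=
  RingQuot (StarClosure r)

namespace UniversalStarAlgebra

variable {X : Type} {r : FreeStarAlgebra X → FreeStarAlgebra X → Prop}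

instance : Ring (UniversalStarAlgebra X r) := inferInstanceAs (Ring (RingQuot (StarClosure r)))

instance : Algebra ℂ (UniversalStarAlgebra X r) :=
  inferInstanceAs (Algebra ℂ (RingQuot (StarClosure r)))

instance : StarRing (UniversalStarAlgebra X r) :=
  RingQuot.starRing (StarClosure r) (StarClosure.star_rel r)

/-- The quotient map, as an algebra map. -/
def mkAux : FreeStarAlgebra X →ₐ[ℂ] UniversalStarAlgebra X r :=
  RingQuot.mkAlgHom ℂ (StarClosure r)

theorem mkAux_star (a : FreeStarAlgebra X) : mkAux (r := r) (star a) = star (mkAux a) := by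
  have h : ∀ b : FreeStarAlgebra X, mkAux (r := r) b = RingQuot.mkRingHom (StarClosure r) b :=
    fun b => by rw [← RingQuot.mkAlgHom_coe ℂ]; rfl
  rw [h, h, RingQuot.mkRingHom_def]
  rfl

theorem mkAux_surjective : Function.Surjective (mkAux (r := r)) :=
  RingQuot.mkAlgHom_surjective ℂ (StarClosure r)

instance : StarModule ℂ (UniversalStarAlgebra X r) where
  star_smul c a := by
    obtain ⟨a, rfl⟩ := mkAux_surjective a
    rw [← map_smul, ← mkAux_star, star_smul, map_smul, mkAux_star]

/-- The quotient map. -/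
def mk : FreeStarAlgebra X →⋆ₐ[ℂ] UniversalStarAlgebra X r :=
  { mkAux with map_star' := mkAux_star }

theorem mk_surjective : Function.Surjective (mk (r := r)) := mkAux_surjective

theorem mk_rel {x y : FreeStarAlgebra X} (h : r x y) : mk (r := r) x = mk y :=
  RingQuot.mkAlgHom_rel ℂ (StarClosure.of h)

/-- The generator `x`. -/
def gen (x : X) : UniversalStarAlgebra X r := mk (FreeStarAlgebra.gen x)

variable {R : Type*} [Ring R] [StarRing R] [Algebra ℂ R] [StarModule ℂ R]

theorem lift_rel (f : X → R)
    (hf : ∀ x y, r x y → FreeStarAlgebra.lift f x = FreeStarAlgebra.lift f y)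
    ⦃x y : FreeStarAlgebra X⦄ (h : StarClosure r x y) :
    (FreeStarAlgebra.lift f).toAlgHom x = (FreeStarAlgebra.lift f).toAlgHom y := by
  show FreeStarAlgebra.lift f x = FreeStarAlgebra.lift f y
  cases h with
  | of h => exact hf _ _ h
  | star h => rw [map_star, map_star, hf _ _ h]

/-- The *-homomorphism given by elements of `R` which satisfy the relations. -/
def lift (f : X → R)
    (hf : ∀ x y, r x y → FreeStarAlgebra.lift f x = FreeStarAlgebra.lift f y) :
    UniversalStarAlgebra X r →⋆ₐ[ℂ] R :=
  let g : UniversalStarAlgebra X r →ₐ[ℂ] R :=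
    RingQuot.liftAlgHom ℂ ⟨(FreeStarAlgebra.lift f).toAlgHom, lift_rel f hf⟩
  have hg : ∀ a, g (mkAux a) = FreeStarAlgebra.lift f a := fun a =>
    RingQuot.liftAlgHom_mkAlgHom_apply ℂ (FreeStarAlgebra.lift f).toAlgHom (lift_rel f hf) a
  { g with
    map_star' := fun a => by
      obtain ⟨a, rfl⟩ := mkAux_surjective a
      show g (star (mkAux a)) = star (g (mkAux a))
      rw [← mkAux_star, hg, hg, map_star] }

theorem lift_mk (f : X → R)
    (hf : ∀ x y, r x y → FreeStarAlgebra.lift f x = FreeStarAlgebra.lift f y)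
    (a : FreeStarAlgebra X) :
    lift (r := r) f hf (mk a) = FreeStarAlgebra.lift f a :=
  RingQuot.liftAlgHom_mkAlgHom_apply ℂ (FreeStarAlgebra.lift f).toAlgHom (lift_rel f hf) a

theorem lift_gen (f : X → R)
    (hf : ∀ x y, r x y → FreeStarAlgebra.lift f x = FreeStarAlgebra.lift f y) (x : X) :
    lift (r := r) f hf (gen x) = f x := by
  rw [gen, lift_mk, FreeStarAlgebra.lift_gen]

end UniversalStarAlgebra

/-! ### Notation: phases and integer powers -/

/-- `phase t = e^{iπt}`. -/
def phase (t : ℝ) : ℂ := Complex.exp (Complex.I * Real.pi * t)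

/-- `x^μ` for `μ ∈ ℤ`, where `x^{-n} = (x*)^n`. -/
def starZPow {R : Type*} [Monoid R] [Star R] (x : R) (μ : ℤ) : R :=
  if 0 ≤ μ then x ^ μ.toNat else star x ^ (-μ).toNat

/-! ### The Heegaard quantum sphere -/

/-- The defining relations of the Heegaard quantum sphere, for elements `a`, `b` of a *-algebra. -/
inductive SphereRel (p q θ : ℝ) {R : Type*} [Ring R] [StarRing R] [Algebra ℂ R] (a b : R) :
    R → R → Prop
  | ab : SphereRel p q θ a b (a * b) (phase (2 * θ) • (b * a))
  | ab_star : SphereRel p q θ a b (a * star b) (phase (-(2 * θ)) • (star b * a))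
  | disc_a : SphereRel p q θ a b (star a * a - (p : ℂ) • (a * star a)) (algebraMap ℂ R (1 - p))
  | disc_b : SphereRel p q θ a b (star b * b - (q : ℂ) • (b * star b)) (algebraMap ℂ R (1 - q))
  | mul_zero : SphereRel p q θ a b ((1 - a * star a) * (1 - b * star b)) 0

theorem SphereRel.map {p q θ : ℝ} {R S : Type*} [Ring R] [StarRing R] [Algebra ℂ R]
    [Ring S] [StarRing S] [Algebra ℂ S] (φ : R →⋆ₐ[ℂ] S) {a b x y : R}
    (h : SphereRel p q θ a b x y) : SphereRel p q θ (φ a) (φ b) (φ x) (φ y) := by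
  cases h with
  | ab => simp only [map_mul, map_smul]; exact .ab
  | ab_star => simp only [map_mul, map_smul, map_star]; exact .ab_star
  | disc_a =>
    rw [map_sub, map_mul, map_smul, map_mul, map_star, AlgHomClass.commutes]; exact .disc_a
  | disc_b =>
    rw [map_sub, map_mul, map_smul, map_mul, map_star, AlgHomClass.commutes]; exact .disc_b
  | mul_zero =>
    simp only [map_sub, map_mul, map_one, map_star, map_zero]; exact .mul_zero

inductive SphereGen : Type
  | a | b

/-- The coordinate *-algebra `O(S³_{pqθ})` of the Heegaard quantum sphere. -/
abbrev Sphere (p q θ : ℝ) : Type :=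
  UniversalStarAlgebra SphereGen
    (SphereRel p q θ (FreeStarAlgebra.gen SphereGen.a) (FreeStarAlgebra.gen SphereGen.b))

namespace Sphere

def a (p q θ : ℝ) : Sphere p q θ := UniversalStarAlgebra.gen SphereGen.a

def b (p q θ : ℝ) : Sphere p q θ := UniversalStarAlgebra.gen SphereGen.b

theorem relations (p q θ : ℝ) {x y : Sphere p q θ}
    (h : SphereRel p q θ (a p q θ) (b p q θ) x y) : x = y := by
  have key : ∀ {x y}, SphereRel p q θ (FreeStarAlgebra.gen SphereGen.a)
      (FreeStarAlgebra.gen SphereGen.b) x y →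
      (UniversalStarAlgebra.mk x : Sphere p q θ) = UniversalStarAlgebra.mk y :=
    fun h => UniversalStarAlgebra.mk_rel h
  cases h with
  | ab =>
    have := key .ab
    simp only [map_mul, map_smul] at this; exact this
  | ab_star =>
    have := key .ab_star
    simp only [map_mul, map_smul, map_star] at this; exact this
  | disc_a =>
    have := key .disc_a
    rw [map_sub, map_mul, map_smul, map_mul, map_star, AlgHomClass.commutes] at this; exact this
  | disc_b =>
    have := key .disc_b
    rw [map_sub, map_mul, map_smul, map_mul, map_star, AlgHomClass.commutes] at this; exact this
  | mul_zero =>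
    have := key .mul_zero
    simp only [map_sub, map_mul, map_one, map_star, map_zero] at this; exact this

end Sphere

/-! ### The quantum lens space -/

/-- The relations making `u` a unitary with `u ^ N = 1`. -/
inductive CyclicRel (N : ℕ) {R : Type*} [Ring R] [StarRing R] (u : R) : R → R → Prop
  | star_mul : CyclicRel N u (star u * u) 1
  | mul_star : CyclicRel N u (u * star u) 1
  | pow : CyclicRel N u (u ^ N) 1

/-- The coordinate *-algebra `O(ℤ/N)`, generated by a unitary `u` with `u ^ N = 1`. -/
abbrev Cyclic (N : ℕ) : Type :=
  UniversalStarAlgebra Unit (CyclicRel N (FreeStarAlgebra.gen ()))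

def Cyclic.u (N : ℕ) : Cyclic N := UniversalStarAlgebra.gen ()

theorem Cyclic.star_u_mul_u (N : ℕ) : star (Cyclic.u N) * Cyclic.u N = 1 := by
  have h : (UniversalStarAlgebra.mk (star (FreeStarAlgebra.gen ()) * FreeStarAlgebra.gen ()) :
      Cyclic N) = UniversalStarAlgebra.mk 1 := UniversalStarAlgebra.mk_rel .star_mul
  simp only [map_mul, map_star, map_one] at h; exact h

theorem Cyclic.u_mul_star_u (N : ℕ) : Cyclic.u N * star (Cyclic.u N) = 1 := by
  have h : (UniversalStarAlgebra.mk (FreeStarAlgebra.gen () * star (FreeStarAlgebra.gen ())) :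
      Cyclic N) = UniversalStarAlgebra.mk 1 := UniversalStarAlgebra.mk_rel .mul_star
  simp only [map_mul, map_star, map_one] at h; exact h

theorem coaction_relations (p q θ : ℝ) (N : ℕ) {x y : Sphere p q θ ⊗[ℂ] Cyclic N}
    (h : SphereRel p q θ (Sphere.a p q θ ⊗ₜ[ℂ] Cyclic.u N) (Sphere.b p q θ ⊗ₜ[ℂ] Cyclic.u N)
      x y) : x = y := by
  cases h with
  | ab =>
    rw [Algebra.TensorProduct.tmul_mul_tmul, Algebra.TensorProduct.tmul_mul_tmul,
      Sphere.relations p q θ .ab, TensorProduct.smul_tmul']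
  | ab_star =>
    rw [TensorProduct.star_tmul, Algebra.TensorProduct.tmul_mul_tmul,
      Algebra.TensorProduct.tmul_mul_tmul, Cyclic.star_u_mul_u, Cyclic.u_mul_star_u,
      Sphere.relations p q θ .ab_star, TensorProduct.smul_tmul']
  | disc_a =>
    rw [TensorProduct.star_tmul, Algebra.TensorProduct.tmul_mul_tmul,
      Algebra.TensorProduct.tmul_mul_tmul, Cyclic.star_u_mul_u, Cyclic.u_mul_star_u,
      TensorProduct.smul_tmul', ← TensorProduct.sub_tmul, Sphere.relations p q θ .disc_a,
      Algebra.TensorProduct.algebraMap_apply]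
  | disc_b =>
    rw [TensorProduct.star_tmul, Algebra.TensorProduct.tmul_mul_tmul,
      Algebra.TensorProduct.tmul_mul_tmul, Cyclic.star_u_mul_u, Cyclic.u_mul_star_u,
      TensorProduct.smul_tmul', ← TensorProduct.sub_tmul, Sphere.relations p q θ .disc_b,
      Algebra.TensorProduct.algebraMap_apply]
  | mul_zero =>
    rw [TensorProduct.star_tmul, TensorProduct.star_tmul, Algebra.TensorProduct.tmul_mul_tmul,
      Algebra.TensorProduct.tmul_mul_tmul, Cyclic.u_mul_star_u, Algebra.TensorProduct.one_def,
      ← TensorProduct.sub_tmul, ← TensorProduct.sub_tmul, Algebra.TensorProduct.tmul_mul_tmul,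
      Sphere.relations p q θ .mul_zero, TensorProduct.zero_tmul]

/-- The coaction `O(S³_{pqθ}) → O(S³_{pqθ}) ⊗ O(ℤ/N)`, `a ↦ a ⊗ u`, `b ↦ b ⊗ u`. -/
def coaction (p q θ : ℝ) (N : ℕ) : Sphere p q θ →⋆ₐ[ℂ] Sphere p q θ ⊗[ℂ] Cyclic N :=
  UniversalStarAlgebra.lift (fun x => UniversalStarAlgebra.gen x ⊗ₜ[ℂ] Cyclic.u N)
    (by
      intro x y h
      have h' := h.map (FreeStarAlgebra.lift
        (fun x => (UniversalStarAlgebra.gen x : Sphere p q θ) ⊗ₜ[ℂ] Cyclic.u N))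
      rw [FreeStarAlgebra.lift_gen, FreeStarAlgebra.lift_gen] at h'
      exact coaction_relations p q θ N h')

/-- The coordinate *-algebra `O(L^N_{pqθ})` of the Heegaard quantum lens space of type `N`: the
elements of `O(S³_{pqθ})` invariant under the coaction of `O(ℤ/N)`. -/
def lensAlgebra (p q θ : ℝ) (N : ℕ) : StarSubalgebra ℂ (Sphere p q θ) where
  carrier := {x | coaction p q θ N x = x ⊗ₜ[ℂ] 1}
  mul_mem' {x y} hx hy := by
    simp only [Set.mem_ofPred_eq] at *
    rw [map_mul, hx, hy, Algebra.TensorProduct.tmul_mul_tmul, one_mul]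
  add_mem' {x y} hx hy := by
    simp only [Set.mem_ofPred_eq] at *
    rw [map_add, hx, hy, TensorProduct.add_tmul]
  algebraMap_mem' c := by
    simp only [Set.mem_ofPred_eq]
    rw [AlgHomClass.commutes, Algebra.TensorProduct.algebraMap_apply]
  star_mem' {x} hx := by
    simp only [Set.mem_ofPred_eq] at *
    rw [map_star, hx, TensorProduct.star_tmul, star_one]

/-! ### The polynomials `Q^p_μ` -/

/-- `[n]_p = 1 + p + ⋯ + p^{n-1}`. -/
def qNat (p : ℝ) (n : ℕ) : ℝ := ∑ i ∈ Finset.range n, p ^ i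

/-- `[n]_p! = [1]_p [2]_p ⋯ [n]_p`. -/
def qFactorial (p : ℝ) (n : ℕ) : ℝ := ∏ i ∈ Finset.range n, qNat p (i + 1)

/-- The `p`-deformed binomial coefficient, for `m ≤ n`. -/
def qBinomial (p : ℝ) (n m : ℕ) : ℝ := qFactorial p n / (qFactorial p m * qFactorial p (n - m))

/-- `∑_{m=1}^n (-1)^m p^{-nm + m(m+1)/2} [n choose m]_p Y^m`. -/
def qPolyNat (p : ℝ) (n : ℕ) : Polynomial ℝ :=
  ∑ m ∈ Finset.Icc 1 n,
    Polynomial.C ((-1) ^ m * p ^ (-(n * m : ℤ) + (m * (m + 1) / 2 : ℤ)) * qBinomial p n m) *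
      Polynomial.X ^ m

/-- The polynomials `Q^p_μ(Y)` for `μ ∈ ℤ`. -/
def qPoly (p : ℝ) (μ : ℤ) : Polynomial ℝ :=
  if 0 < μ then qPolyNat p μ.toNat
  else if μ = 0 then 0
  else (qPolyNat p⁻¹ (-μ).toNat).comp (Polynomial.C p * Polynomial.X)

/-- The value `Q^p_μ(x)` at an element `x` of a complex algebra. -/
def qEval {R : Type*} [Ring R] [Algebra ℂ R] (p : ℝ) (μ : ℤ) (x : R) : R :=
  Polynomial.aeval x ((qPoly p μ).map Complex.ofRealHom)

/-! ### The universal *-algebra of the lens space relations -/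

/-- The lens space relations, for elements `a = ã`, `b = b̃`, `z`, `A`, `B` of a *-algebra. -/
inductive LensRel (p q θ : ℝ) (N : ℕ) {R : Type*} [Ring R] [StarRing R] [Algebra ℂ R]
    (a b z A B : R) : R → R → Prop
  | star_A : LensRel p q θ N a b z A B (star A) A
  | star_B : LensRel p q θ N a b z A B (star B) B
  | AB : LensRel p q θ N a b z A B (A * B) 0
  | Az : LensRel p q θ N a b z A B (A * z) ((p : ℂ) • (z * A))
  | zB : LensRel p q θ N a b z A B (z * B) ((q : ℂ) • (B * z))
  | star_z_z : LensRel p q θ N a b z A B (star z * z) (1 - (p : ℂ) • A - B)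
  | z_star_z : LensRel p q θ N a b z A B (z * star z) (1 - A - (q : ℂ) • B)
  | Aa : LensRel p q θ N a b z A B (A * a) ((p : ℂ) ^ N • (a * A))
  | Ab : LensRel p q θ N a b z A B (A * b) (b * A)
  | Ba : LensRel p q θ N a b z A B (B * a) (a * B)
  | Bb : LensRel p q θ N a b z A B (B * b) ((q : ℂ) ^ N • (b * B))
  | za : LensRel p q θ N a b z A B (z * a) (phase (N * 2 * θ) • (a * z))
  | zb_star : LensRel p q θ N a b z A B (z * star b) (phase (-(N * 2 * θ)) • (star b * z))
  | za_star : LensRel p q θ N a b z A B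
      (z * star a - phase (-(N * 2 * θ)) • (star a * z))
      ((phase (-(N * (N + 1) * θ)) * ((p : ℂ) ^ N - 1)) •
        (A * starZPow z (1 - (N : ℤ)) * star b))
  | zb : LensRel p q θ N a b z A B
      (z * b - phase (N * 2 * θ) • (b * z))
      ((phase (θ * N * (N - 1)) * ((q : ℂ) * ((q : ℂ) ^ (-(N : ℤ)) - 1))) •
        (B * starZPow z (1 - (N : ℤ)) * a))
  | ab : LensRel p q θ N a b z A B (a * b) (phase (N ^ 2 * 2 * θ) • (b * a))
  | ab_star : LensRel p q θ N a b z A B (a * star b) (phase (-(N ^ 2 * 2 * θ)) • (star b * a))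
  | ab_star_eq : LensRel p q θ N a b z A B (a * star b) (phase (-(θ * N * (N - 1))) • z ^ N)
  | star_a_a : LensRel p q θ N a b z A B (star a * a) (1 + qEval p (-(N : ℤ)) A)
  | a_star_a : LensRel p q θ N a b z A B (a * star a) (1 + qEval p N A)
  | star_b_b : LensRel p q θ N a b z A B (star b * b) (1 + qEval q (-(N : ℤ)) B)
  | b_star_b : LensRel p q θ N a b z A B (b * star b) (1 + qEval q N B)

inductive LensGen : Type
  | a | b | z | A | B

/-- The universal *-algebra generated by `ã`, `b̃`, `z`, `A`, `B` subject to the lens space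
relations. -/
abbrev LensUniversal (p q θ : ℝ) (N : ℕ) : Type :=
  UniversalStarAlgebra LensGen
    (LensRel p q θ N (FreeStarAlgebra.gen LensGen.a) (FreeStarAlgebra.gen LensGen.b)
      (FreeStarAlgebra.gen LensGen.z) (FreeStarAlgebra.gen LensGen.A)
      (FreeStarAlgebra.gen LensGen.B))

/-- A generator of the universal *-algebra of the lens space relations. -/
def lensGen (p q θ : ℝ) (N : ℕ) (x : LensGen) : LensUniversal p q θ N :=
  UniversalStarAlgebra.gen x

/-- The vectors `A^k z^μ b̃^ν` with `k > 0` and `B^k z^μ ã^ν` with `k ≥ 0`. -/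
def lensBasisVector (p q θ : ℝ) (N : ℕ) : (ℕ+ × ℤ × ℤ) ⊕ (ℕ × ℤ × ℤ) → LensUniversal p q θ N
  | Sum.inl (k, μ, ν) =>
      lensGen p q θ N .A ^ (k : ℕ) * starZPow (lensGen p q θ N .z) μ *
        starZPow (lensGen p q θ N .b) ν
  | Sum.inr (k, μ, ν) =>
      lensGen p q θ N .B ^ k * starZPow (lensGen p q θ N .z) μ *
        starZPow (lensGen p q θ N .a) ν

end HeegaardLens

end

open HeegaardLens

open scoped TensorProduct

noncomputable section

namespace HeegaardLens

/-! ### Phases -/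

/-! The homomorphism `ψ` from the universal algebra to the sphere, given by `ã ↦ a^N`, `b̃ ↦ b^N`,
`z ↦ ab*` and so on, exists because the lens relations hold for these elements
(`SphereRel.lensRel`). The polynomials `Q` enter through the product `1 + Q^p_n(Y) = ∏_{i<n} (1 -
p^{-i} Y)`, which is what `a^n a*^n` becomes when every `A` is moved to the left.

The rest is a comparison of bases. The relations alone force the listed vectors to span
(`LensRel.span_lensVector`). The element `A` is normal. Modulo `AR` the generator `ã` is unitary and
`b̃` is expressible through `ã` and `z*`, which leaves the ordered monomials `B^k z^μ ã^ν`. The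
ideal `AR` is a copy of `R / ann(A)`, where `B = 0`, `b̃` is unitary and `ã` is redundant; this
gives `A^k z^μ b̃^ν` with `k > 0`.

The images of the vectors in the sphere are linearly independent
(`linearIndependent_sphereLensVector`). Two representations by weighted shifts show this, one with
`a` unitary and `A = 0`, the other with `b` unitary. Shift vectors separate `(μ, ν)`, and the powers
of `A` or `B` are separated because a nonzero polynomial has finitely many roots. Hence the vectors
are a basis and `ψ` is injective.

For the image, the case `N = 1` of both statements gives a basis of the whole sphere, homogeneous of
degree `ν`. A rotation by a primitive `N`-th root of unity fixes the lens algebra, so only basis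
vectors with `N ∣ ν` occur in its elements, and these are the images of the listed vectors
(`lensAlgebra_le_span`). -/

theorem phase_add (s t : ℝ) : phase (s + t) = phase s * phase t := by
  rw [phase, phase, phase, ← Complex.exp_add]; push_cast; ring_nf

@[simp] theorem phase_zero : phase 0 = 1 := by simp [phase]

theorem phase_ne_zero (t : ℝ) : phase t ≠ 0 := Complex.exp_ne_zero _

theorem phase_mul_phase_neg (t : ℝ) : phase t * phase (-t) = 1 := by
  rw [← phase_add]; simp

theorem phase_neg (t : ℝ) : phase (-t) = (phase t)⁻¹ :=
  eq_inv_of_mul_eq_one_right (phase_mul_phase_neg t)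

theorem phase_pow (t : ℝ) (n : ℕ) : phase t ^ n = phase (n * t) := by
  rw [phase, phase, ← Complex.exp_nat_mul]; push_cast; ring_nf

theorem star_phase (t : ℝ) : star (phase t) = phase (-t) := by
  rw [phase, phase, Complex.star_def, ← Complex.exp_conj]
  simp

/-! ### Integer powers of a pair of elements -/

/-- `x ^ μ` for `μ ≥ 0` and `y ^ (-μ)` for `μ < 0`. -/
def pairZPow {R : Type*} [Monoid R] (x y : R) (μ : ℤ) : R :=
  if 0 ≤ μ then x ^ μ.toNat else y ^ (-μ).toNat

section pairZPow

variable {R : Type*} [Monoid R]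

/-- The two-element form survives in quotient rings and operator algebras that carry no star, where
the image of `x*` is just a second element. -/
theorem starZPow_eq_pairZPow [Star R] (x : R) (μ : ℤ) :
    starZPow x μ = pairZPow x (star x) μ := rfl

@[simp] theorem pairZPow_natCast (x y : R) (n : ℕ) : pairZPow x y n = x ^ n := by
  simp [pairZPow]

@[simp] theorem pairZPow_neg_natCast (x y : R) (n : ℕ) : pairZPow x y (-(n : ℤ)) = y ^ n := by
  rcases Nat.eq_zero_or_pos n with rfl | h
  · simp [pairZPow]
  · rw [pairZPow, if_neg (by omega)]; simp

@[simp] theorem pairZPow_zero (x y : R) : pairZPow x y 0 = 1 := by simp [pairZPow]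

theorem map_pairZPow {S F : Type*} [Monoid S] [FunLike F R S] [MonoidHomClass F R S] (f : F)
    (x y : R) (μ : ℤ) : f (pairZPow x y μ) = pairZPow (f x) (f y) μ := by
  unfold pairZPow; split_ifs <;> simp

theorem pairZPow_units (w : Rˣ) (μ : ℤ) :
    pairZPow (w : R) ((w⁻¹ : Rˣ) : R) μ = ((w ^ μ : Rˣ) : R) := by
  obtain ⟨n, rfl | rfl⟩ := μ.eq_nat_or_neg
  · simp
  · rw [pairZPow_neg_natCast, zpow_neg, zpow_natCast, ← inv_pow, Units.val_pow_eq_pow_val]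

theorem pairZPow_pow_natCast_mul (x y : R) (n : ℕ) (μ : ℤ) :
    pairZPow (x ^ n) (y ^ n) μ = pairZPow x y (n * μ) := by
  obtain ⟨m, rfl | rfl⟩ := μ.eq_nat_or_neg
  · rw [← Nat.cast_mul, pairZPow_natCast, pairZPow_natCast, pow_mul]
  · rw [mul_neg, ← Nat.cast_mul, pairZPow_neg_natCast, pairZPow_neg_natCast, pow_mul]

end pairZPow

/-! ### Elements which commute up to a scalar -/

section QComm

variable {R : Type*} [Ring R] [Algebra ℂ R]

theorem qcomm_pow_right {c : ℂ} {x y : R} (h : x * y = c • (y * x)) (m : ℕ) :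
    x * y ^ m = c ^ m • (y ^ m * x) := by
  induction m with
  | zero => simp
  | succ m ih =>
    rw [pow_succ, ← mul_assoc, ih, smul_mul_assoc, mul_assoc, h, mul_smul_comm, smul_smul,
      pow_succ, mul_assoc]

theorem qcomm_pow_left {c : ℂ} {x y : R} (h : x * y = c • (y * x)) (n : ℕ) :
    x ^ n * y = c ^ n • (y * x ^ n) := by
  induction n with
  | zero => simp
  | succ n ih =>
    rw [pow_succ, mul_assoc, h, mul_smul_comm, ← mul_assoc, ih, smul_mul_assoc, smul_smul,
      mul_assoc, pow_succ, mul_comm c]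

theorem qcomm_pow_pow {c : ℂ} {x y : R} (h : x * y = c • (y * x)) (n m : ℕ) :
    x ^ n * y ^ m = c ^ (n * m) • (y ^ m * x ^ n) := by
  rw [qcomm_pow_right (qcomm_pow_left h n), ← pow_mul]

theorem qcomm_inv {c d : ℂ} (hcd : d * c = 1) {x y : R} (h : x * y = c • (y * x)) :
    y * x = d • (x * y) := by
  rw [h, smul_smul, hcd, one_smul]

/-- If `yx = e^{iπ2s} xy` then `(xy)^n = e^{iπsn(n-1)} x^n y^n`. -/
theorem mul_pow_of_qcomm {s : ℝ} {x y : R} (h : y * x = phase (2 * s) • (x * y)) (n : ℕ) :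
    (x * y) ^ n = phase (s * n * (n - 1)) • (x ^ n * y ^ n) := by
  induction n with
  | zero => simp
  | succ n ih =>
    have h1 : y ^ n * x = phase (n * (2 * s)) • (x * y ^ n) := by
      rw [qcomm_pow_left h, phase_pow]
    have h2 : x ^ n * y ^ n * (x * y) = phase (n * (2 * s)) • (x ^ (n + 1) * y ^ (n + 1)) := by
      calc x ^ n * y ^ n * (x * y) = x ^ n * (y ^ n * x) * y := by simp only [mul_assoc]
        _ = _ := by
          rw [h1, mul_smul_comm, smul_mul_assoc, pow_succ, pow_succ]; simp only [mul_assoc]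
    rw [pow_succ, ih, smul_mul_assoc, h2, smul_smul, ← phase_add]
    congr 2
    push_cast; ring

end QComm

/-! ### The `q`-binomial theorem -/

section QBinomial

variable {p : ℝ}

theorem qNat_pos (hp : 0 < p) (n : ℕ) : 0 < qNat p (n + 1) :=
  Finset.sum_pos (fun _ _ => pow_pos hp _) ⟨0, by simp⟩

theorem qFactorial_pos (hp : 0 < p) (n : ℕ) : 0 < qFactorial p n :=
  Finset.prod_pos fun _ _ => qNat_pos hp _

theorem qFactorial_succ (p : ℝ) (n : ℕ) : qFactorial p (n + 1) = qFactorial p n * qNat p (n + 1) :=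
  Finset.prod_range_succ _ _

theorem qNat_add (p : ℝ) (m n : ℕ) : qNat p (m + n) = qNat p m + p ^ m * qNat p n := by
  simp only [qNat, Finset.sum_range_add, pow_add, Finset.mul_sum]

theorem qBinomial_zero_right (hp : 0 < p) (n : ℕ) : qBinomial p n 0 = 1 := by
  have h := (qFactorial_pos hp n).ne'
  have h0 : qFactorial p 0 = 1 := by simp [qFactorial]
  simp [qBinomial, h0, h]

theorem qBinomial_self (hp : 0 < p) (n : ℕ) : qBinomial p n n = 1 := by
  have h := (qFactorial_pos hp n).ne'
  have h0 : qFactorial p 0 = 1 := by simp [qFactorial]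
  simp [qBinomial, h0, h]

/-- The `q`-Pascal rule. -/
theorem qBinomial_succ_succ (hp : 0 < p) (m k : ℕ) :
    qBinomial p (m + 1 + k + 1) (m + 1) =
      p ^ (m + 1) * qBinomial p (m + 1 + k) (m + 1) + qBinomial p (m + 1 + k) m := by
  -- Parametrizing the upper index as `m + 1 + k` makes the truncated subtractions in the three
  -- binomials exact.
  have h1 : m + 1 + k + 1 - (m + 1) = k + 1 := by omega
  have h2 : m + 1 + k - (m + 1) = k := by omega
  have h3 : m + 1 + k - m = k + 1 := by omega
  have e1 := (qFactorial_pos hp m).ne'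
  have e2 := (qFactorial_pos hp k).ne'
  have e3 := (qNat_pos hp m).ne'
  have e4 := (qNat_pos hp k).ne'
  have h4 : qNat p (m + 1 + k + 1) = qNat p (m + 1) + p ^ (m + 1) * qNat p (k + 1) := by
    rw [add_assoc (m + 1), qNat_add]
  rw [qBinomial, qBinomial, qBinomial, h1, h2, h3, qFactorial_succ p (m + 1 + k), h4,
    qFactorial_succ p m, qFactorial_succ p k]
  field_simp
  ring

/-- The coefficients of the polynomial `1 + Q^p_n`. -/
def qCoeff (p : ℝ) (n m : ℕ) : ℝ :=
  if m ≤ n then (-1) ^ m * p ^ (-(n * m : ℤ) + (m * (m + 1) / 2 : ℤ)) * qBinomial p n m else 0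

theorem coeff_one_add_qPolyNat (hp : 0 < p) (n m : ℕ) :
    (1 + qPolyNat p n).coeff m = qCoeff p n m := by
  rw [qPolyNat, Polynomial.coeff_add, Polynomial.finsetSum_coeff, qCoeff]
  simp only [Polynomial.coeff_C_mul, Polynomial.coeff_X_pow, Polynomial.coeff_one, mul_ite,
    mul_one, mul_zero]
  rw [Finset.sum_ite_eq]
  rcases Nat.eq_zero_or_pos m with rfl | hm
  · simp [qBinomial_zero_right hp]
  · simp [hm.ne', Nat.succ_le_iff, hm]

theorem triangle_succ (m : ℤ) : (m + 1) * (m + 1 + 1) / 2 = m * (m + 1) / 2 + (m + 1) := by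
  rw [show (m + 1) * (m + 1 + 1) = m * (m + 1) + (m + 1) * 2 by ring,
    Int.add_mul_ediv_right _ _ (by norm_num)]

/-- The weight `p^(-nm + m(m+1)/2)` absorbs the powers of `p` in the `q`-Pascal rule, leaving the
recursion for multiplication by `1 - p^{-n} Y`. -/
theorem qCoeff_succ (hp : 0 < p) (n m : ℕ) :
    qCoeff p (n + 1) (m + 1) = qCoeff p n (m + 1) - p ^ (-(n : ℤ)) * qCoeff p n m := by
  have hp' := hp.ne'
  rcases lt_trichotomy m n with h | rfl | h
  · obtain ⟨k, rfl⟩ := Nat.exists_eq_add_of_lt h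
    rw [qCoeff, qCoeff, qCoeff, if_pos (by omega), if_pos (by omega), if_pos (by omega),
      show m + k + 1 = m + 1 + k by ring, qBinomial_succ_succ hp]
    push_cast
    rw [triangle_succ]
    set T : ℤ := (m : ℤ) * (m + 1) / 2
    have e1 : p ^ (-(((m : ℤ) + 1 + k) * (m + 1)) + (T + (m + 1))) =
        p ^ (-(((m : ℤ) + 1 + k + 1) * (m + 1)) + (T + (m + 1))) * p ^ (m + 1) := by
      rw [← zpow_natCast, ← zpow_add₀ hp']; congr 1; push_cast; ring
    have e2 : p ^ (-((m : ℤ) + 1 + k)) * p ^ (-(((m : ℤ) + 1 + k) * m) + T) =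
        p ^ (-(((m : ℤ) + 1 + k + 1) * (m + 1)) + (T + (m + 1))) := by
      rw [← zpow_add₀ hp']; congr 1; ring
    calc _ = (-1) ^ (m + 1) * (p ^ (-(((m : ℤ) + 1 + k + 1) * (m + 1)) + (T + (m + 1))) *
            p ^ (m + 1)) * qBinomial p (m + 1 + k) (m + 1) -
          (-1) ^ m * p ^ (-(((m : ℤ) + 1 + k + 1) * (m + 1)) + (T + (m + 1))) *
            qBinomial p (m + 1 + k) m := by ring
      _ = _ := by rw [← e1, ← e2]; ring
  -- At the top coefficient the cutoff in `qCoeff` supplies the zero: `qBinomial p n (n + 1)` is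
  -- nonzero because of truncated subtraction.
  · rw [qCoeff, qCoeff, qCoeff, if_pos le_rfl, if_neg (by omega), if_pos le_rfl,
      qBinomial_self hp, qBinomial_self hp]
    push_cast
    rw [triangle_succ]
    set T : ℤ := (m : ℤ) * (m + 1) / 2
    have e2 : p ^ (-(m : ℤ)) * p ^ (-((m : ℤ) * m) + T) =
        p ^ (-(((m : ℤ) + 1) * (m + 1)) + (T + (m + 1))) := by
      rw [← zpow_add₀ hp']; congr 1; ring
    rw [← e2]; ring
  · rw [qCoeff, qCoeff, qCoeff, if_neg (by omega), if_neg (by omega), if_neg (by omega)]; simp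

theorem one_add_qPolyNat_succ (hp : 0 < p) (n : ℕ) :
    1 + qPolyNat p (n + 1) =
      (1 - Polynomial.C (p ^ (-(n : ℤ))) * Polynomial.X) * (1 + qPolyNat p n) := by
  ext m
  rw [sub_mul, one_mul, Polynomial.coeff_sub, mul_assoc, Polynomial.coeff_C_mul]
  cases m with
  | zero => simp [coeff_one_add_qPolyNat hp, qCoeff, qBinomial_zero_right hp]
  | succ m =>
    rw [Polynomial.coeff_X_mul, coeff_one_add_qPolyNat hp, coeff_one_add_qPolyNat hp,
      coeff_one_add_qPolyNat hp, qCoeff_succ hp]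

variable {R : Type*} [Ring R] [Algebra ℂ R]

theorem qEval_natCast (p : ℝ) (n : ℕ) (x : R) :
    qEval p n x = Polynomial.aeval x ((qPolyNat p n).map Complex.ofRealHom) := by
  rcases Nat.eq_zero_or_pos n with rfl | h
  · simp [qEval, qPoly, qPolyNat]
  · simp [qEval, qPoly, h]

/-- Negative indices reduce to positive ones with base `p⁻¹`, so one product formula serves both
`a^n a*^n` and `a*^n a^n`. -/
theorem qEval_neg_natCast (p : ℝ) (n : ℕ) (x : R) :
    qEval p (-(n : ℤ)) x = qEval p⁻¹ n ((p : ℂ) • x) := by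
  rw [qEval_natCast]
  rcases Nat.eq_zero_or_pos n with rfl | h
  · simp [qEval, qPoly, qPolyNat]
  · rw [qEval, qPoly, if_neg (by omega), if_neg (by omega)]
    simp [Polynomial.map_comp, Polynomial.aeval_comp, Algebra.smul_def]

theorem qEval_zero (p : ℝ) (n : ℕ) : qEval p n (0 : R) = 0 := by
  rw [qEval_natCast, qPolyNat, Polynomial.map_sum, map_sum]
  refine Finset.sum_eq_zero fun m hm => ?_
  have : m ≠ 0 := by have := (Finset.mem_Icc.mp hm).1; omega
  simp [this]

theorem map_qEval {S : Type*} [Ring S] [Algebra ℂ S] (f : R →ₐ[ℂ] S) (p : ℝ) (μ : ℤ) (x : R) :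
    f (qEval p μ x) = qEval p μ (f x) := by
  rw [qEval, qEval, Polynomial.aeval_algHom_apply]

/-- A sequence with `f (n + 1) = (1 - p^{-n} x) f n` is `1 + Q^p_n(x)`. -/
theorem eq_one_add_qEval (hp : 0 < p) (x : R) (f : ℕ → R) (h0 : f 0 = 1)
    (hf : ∀ n, f (n + 1) = (1 - ((p : ℂ)⁻¹ ^ n) • x) * f n) (n : ℕ) : f n = 1 + qEval p n x := by
  have key : ∀ n : ℕ, 1 + qEval p n x =
      Polynomial.aeval x ((1 + qPolyNat p n).map Complex.ofRealHom) := by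
    intro n; rw [qEval_natCast]; simp
  induction n with
  | zero => rw [h0, qEval_natCast]; simp [qPolyNat]
  | succ n ih =>
    rw [hf, ih, key, key, one_add_qPolyNat_succ hp]
    simp [Algebra.smul_def]

end QBinomial

/-! ### Normal ordering -/

section NormalOrder

variable {S : Type*} [Ring S] [Algebra ℂ S]

/-- The ordered monomials `D^k z^μ w^ν`. -/
def orderedMonomial (D z z' : S) (w : Sˣ) (i : ℕ × ℤ × ℤ) : S :=
  D ^ i.1 * pairZPow z z' i.2.1 * ((w ^ i.2.2 : Sˣ) : S)

variable {D z z' : S} {w : Sˣ} {r s t μ : ℂ}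

theorem mul_mem_span_of_forall {ι : Type*} {v : ι → S} {x : S}
    (h : ∀ i, x * v i ∈ Submodule.span ℂ (Set.range v)) {y : S}
    (hy : y ∈ Submodule.span ℂ (Set.range v)) : x * y ∈ Submodule.span ℂ (Set.range v) := by
  have : Submodule.span ℂ (Set.range v) ≤
      (Submodule.span ℂ (Set.range v)).comap (LinearMap.mulLeft ℂ x) := by
    rw [Submodule.span_le]; rintro _ ⟨i, rfl⟩; exact h i
  exact this hy

theorem D_mul_mem_span_orderedMonomial {y : S}
    (hy : y ∈ Submodule.span ℂ (Set.range (orderedMonomial D z z' w))) :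
    D * y ∈ Submodule.span ℂ (Set.range (orderedMonomial D z z' w)) := by
  refine mul_mem_span_of_forall (fun ⟨k, i, j⟩ => ?_) hy
  refine Submodule.subset_span ⟨(k + 1, i, j), ?_⟩
  simp only [orderedMonomial, pow_succ', mul_assoc]

theorem D_pow_mul_mem_span_orderedMonomial (k : ℕ) {y : S}
    (hy : y ∈ Submodule.span ℂ (Set.range (orderedMonomial D z z' w))) :
    D ^ k * y ∈ Submodule.span ℂ (Set.range (orderedMonomial D z z' w)) := by
  induction k with
  | zero => simpa
  | succ k ih => rw [pow_succ', mul_assoc]; exact D_mul_mem_span_orderedMonomial ih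

/-- The span contains `1`, so it is everything once it is stable under left multiplication by the
generators. All pairs commute up to a scalar except `z, z'`, whose products collapse to polynomials
in `D`; hence no mixed word in `z, z'` survives. The free constants let it serve both `R / AR` (`D =
B`, `w = ã`) and `R / ann(A)` (`D = A`, `w = b̃`). -/
theorem span_orderedMonomial (hr : r ≠ 0) (hμ : μ ≠ 0)
    (hDz : D * z = r • (z * D)) (hDz' : z' * D = r • (D * z'))
    (hzz : z' * z = 1 - s • D) (hzz' : z * z' = 1 - t • D) (hDw : D * w = w * D)
    (hzw : z * w = μ • (w * z)) (hzw' : z' * w = μ⁻¹ • (w * z'))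
    (htop : Algebra.adjoin ℂ {D, z, z', (w : S), ((w⁻¹ : Sˣ) : S)} = ⊤) :
    Submodule.span ℂ (Set.range (orderedMonomial D z z' w)) = ⊤ := by
  set T := Submodule.span ℂ (Set.range (orderedMonomial D z z' w))
  have hmon : ∀ (k : ℕ) (i j : ℤ), D ^ k * (pairZPow z z' i * ((w ^ j : Sˣ) : S)) ∈ T :=
    fun k i j => Submodule.subset_span ⟨(k, i, j), by simp only [orderedMonomial, mul_assoc]⟩
  have hmon0 : ∀ (i j : ℤ), pairZPow z z' i * ((w ^ j : Sˣ) : S) ∈ T :=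
    fun i j => by simpa using hmon 0 i j
  have hDT : ∀ y ∈ T, ∀ k, D ^ k * y ∈ T := fun y hy k => D_pow_mul_mem_span_orderedMonomial k hy
  have hD1T : ∀ (c : ℂ), ∀ y ∈ T, (1 - c • D) * y ∈ T := fun c y hy => by
    rw [sub_mul, one_mul, smul_mul_assoc]
    exact T.sub_mem hy (T.smul_mem _ (D_mul_mem_span_orderedMonomial hy))
  have hz_mul : ∀ i j : ℤ, z * (pairZPow z z' i * ((w ^ j : Sˣ) : S)) ∈ T := by
    intro i j
    obtain ⟨n, rfl | rfl⟩ := i.eq_nat_or_neg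
    · have := hmon0 ((n + 1 : ℕ) : ℤ) j
      rwa [pairZPow_natCast, pow_succ', mul_assoc] at this
    · cases n with
      | zero => simpa [pairZPow] using hmon0 1 j
      | succ n =>
        -- Here `z` meets a power of `z'`, and `z z' = 1 - t D` shortens it.
        rw [pairZPow_neg_natCast, pow_succ', ← mul_assoc, ← mul_assoc, hzz', mul_assoc]
        have := hmon0 (-(n : ℤ)) j
        rw [pairZPow_neg_natCast] at this
        exact hD1T _ _ this
  have hz'_mul : ∀ i j : ℤ, z' * (pairZPow z z' i * ((w ^ j : Sˣ) : S)) ∈ T := by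
    intro i j
    obtain ⟨n, rfl | rfl⟩ := i.eq_nat_or_neg
    · cases n with
      | zero => simpa [pairZPow] using hmon0 (-((1 : ℕ) : ℤ)) j
      | succ n =>
        rw [pairZPow_natCast, pow_succ', ← mul_assoc, ← mul_assoc, hzz, mul_assoc]
        have := hmon0 n j
        rw [pairZPow_natCast] at this
        exact hD1T _ _ this
    · have := hmon0 (-((n + 1 : ℕ) : ℤ)) j
      rw [pairZPow_neg_natCast, pow_succ', mul_assoc] at this
      rwa [pairZPow_neg_natCast]
  have hzD : ∀ k, z * D ^ k = (r⁻¹ ^ k) • (D ^ k * z) :=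
    qcomm_pow_right (qcomm_inv (inv_mul_cancel₀ hr) hDz)
  have hz'D : ∀ k, z' * D ^ k = (r ^ k) • (D ^ k * z') := qcomm_pow_right hDz'
  have hDw' : ∀ k, w * D ^ k = D ^ k * w := fun k =>
    ((show Commute D (w : S) from hDw).pow_left k).eq.symm
  have hwz : ∀ i, ∃ c : ℂ, c ≠ 0 ∧ w * pairZPow z z' i = c • (pairZPow z z' i * w) := by
    intro i
    obtain ⟨n, rfl | rfl⟩ := i.eq_nat_or_neg
    · rw [pairZPow_natCast]
      exact ⟨_, pow_ne_zero n (inv_ne_zero hμ),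
        qcomm_pow_right (qcomm_inv (inv_mul_cancel₀ hμ) hzw) n⟩
    · rw [pairZPow_neg_natCast]
      exact ⟨_, pow_ne_zero n hμ, qcomm_pow_right (qcomm_inv (mul_inv_cancel₀ hμ) hzw') n⟩
  -- The scalar must not depend on `j`: the case of `w⁻¹` uses the same identity at `j - 1`.
  have hwmon : ∀ k i, ∃ c : ℂ, c ≠ 0 ∧ ∀ j, (w : S) * orderedMonomial D z z' w (k, i, j) =
      c • orderedMonomial D z z' w (k, i, 1 + j) := by
    intro k i
    obtain ⟨c, hc0, hc⟩ := hwz i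
    refine ⟨c, hc0, fun j => ?_⟩
    simp only [orderedMonomial]
    rw [mul_assoc, ← mul_assoc (w : S), hDw', mul_assoc, ← mul_assoc (w : S), hc, zpow_add]
    simp [mul_assoc]
  have hw : ∀ y ∈ T, w * y ∈ T := fun y hy => by
    refine mul_mem_span_of_forall (fun ⟨k, i, j⟩ => ?_) hy
    obtain ⟨c, hc0, hc⟩ := hwmon k i
    rw [hc]
    exact T.smul_mem _ (Submodule.subset_span ⟨_, rfl⟩)
  have hw' : ∀ y ∈ T, ((w⁻¹ : Sˣ) : S) * y ∈ T := fun y hy => by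
    refine mul_mem_span_of_forall (fun ⟨k, i, j⟩ => ?_) hy
    obtain ⟨c, hc0, hc⟩ := hwmon k i
    -- Factoring out a `w` for `w⁻¹` to cancel avoids commutation rules for `w⁻¹`.
    have : orderedMonomial D z z' w (k, i, j) =
        w * (c⁻¹ • orderedMonomial D z z' w (k, i, -1 + j)) := by
      rw [mul_smul_comm, hc, smul_smul, inv_mul_cancel₀ hc0, one_smul, add_neg_cancel_left]
    rw [this, ← mul_assoc, Units.inv_mul, one_mul]
    exact T.smul_mem _ (Submodule.subset_span ⟨_, rfl⟩)
  have hall : ∀ x ∈ Algebra.adjoin ℂ {D, z, z', (w : S), ((w⁻¹ : Sˣ) : S)}, ∀ y ∈ T,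
      x * y ∈ T := by
    intro x hx
    induction hx using Algebra.adjoin_induction with
    | mem x hx =>
      intro y hy
      rcases hx with rfl | rfl | rfl | rfl | rfl
      · exact D_mul_mem_span_orderedMonomial hy
      · refine mul_mem_span_of_forall (fun ⟨k, i, j⟩ => ?_) hy
        rw [orderedMonomial, mul_assoc, ← mul_assoc x, hzD, smul_mul_assoc, mul_assoc]
        exact T.smul_mem _ (hDT _ (hz_mul _ _) _)
      · refine mul_mem_span_of_forall (fun ⟨k, i, j⟩ => ?_) hy
        rw [orderedMonomial, mul_assoc, ← mul_assoc x, hz'D, smul_mul_assoc, mul_assoc]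
        exact T.smul_mem _ (hDT _ (hz'_mul _ _) _)
      · exact hw y hy
      · exact hw' y hy
    | algebraMap c =>
      intro y hy
      rw [← Algebra.smul_def]; exact T.smul_mem _ hy
    | add x₁ x₂ _ _ h₁ h₂ => intro y hy; rw [add_mul]; exact T.add_mem (h₁ y hy) (h₂ y hy)
    | mul x₁ x₂ _ _ h₁ h₂ => intro y hy; rw [mul_assoc]; exact h₁ _ (h₂ y hy)
  rw [eq_top_iff]
  intro x _
  have h1 : (1 : S) ∈ T := by simpa using hmon0 0 0
  simpa using hall x (htop ▸ Algebra.mem_top) 1 h1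

end NormalOrder

/-! ### Ideals attached to a normal element -/

section Normal

variable {R : Type*} [Ring R]

/-- The right ideal `A R`, which is a left ideal when `R A ⊆ A R`. -/
def mulIdeal (A : R) (h : ∀ x, ∃ y, x * A = A * y) : Ideal R where
  carrier := {x | ∃ y, x = A * y}
  add_mem' := by
    rintro _ _ ⟨x, rfl⟩ ⟨y, rfl⟩; exact ⟨x + y, (mul_add _ _ _).symm⟩
  zero_mem' := ⟨0, (mul_zero _).symm⟩
  smul_mem' := by
    rintro c _ ⟨x, rfl⟩
    obtain ⟨y, hy⟩ := h c
    exact ⟨y * x, by rw [smul_eq_mul, ← mul_assoc, hy, mul_assoc]⟩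

instance (A : R) (h : ∀ x, ∃ y, x * A = A * y) : (mulIdeal A h).IsTwoSided where
  mul_mem_of_left := by
    rintro _ c ⟨x, rfl⟩
    exact ⟨x * c, mul_assoc _ _ _⟩

/-- The right annihilator of `A`, which is a left ideal when `A R ⊆ R A`. -/
def annIdeal (A : R) (h : ∀ x, ∃ y, A * x = y * A) : Ideal R where
  carrier := {x | A * x = 0}
  add_mem' := by
    intro x y hx hy
    simp only [Set.mem_ofPred_eq] at *
    rw [mul_add, hx, hy, add_zero]
  zero_mem' := mul_zero _
  smul_mem' := by
    intro c x hx
    obtain ⟨y, hy⟩ := h c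
    simp only [Set.mem_ofPred_eq] at *
    rw [smul_eq_mul, ← mul_assoc, hy, mul_assoc, hx, mul_zero]

instance (A : R) (h : ∀ x, ∃ y, A * x = y * A) : (annIdeal A h).IsTwoSided where
  mul_mem_of_left := by
    intro x c hx
    change A * x = 0 at hx
    change A * (x * c) = 0
    rw [← mul_assoc, hx, zero_mul]

end Normal

/-! ### Spanning and generation along a surjection. -/

section Lifting

variable {R S : Type*} [Ring R] [Ring S] [Algebra ℂ R] [Algebra ℂ S]

theorem exists_mem_span_map_eq {ι : Type*} (f : R →ₐ[ℂ] S) {v : ι → R} {u : ι → S}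
    (huv : ∀ i, f (v i) = u i) (hu : Submodule.span ℂ (Set.range u) = ⊤) (x : R) :
    ∃ y ∈ Submodule.span ℂ (Set.range v), f y = f x := by
  have : f x ∈ (Submodule.span ℂ (Set.range v)).map f.toLinearMap := by
    rw [Submodule.map_span, ← Set.range_comp]
    have : (f.toLinearMap ∘ v) = u := funext huv
    rw [this, hu]; trivial
  exact this

theorem subalgebra_eq_top_of_surjective (f : R →ₐ[ℂ] S) (hf : Function.Surjective f) {s : Set R}
    (hs : Algebra.adjoin ℂ s = ⊤) (T : Subalgebra ℂ S) (hT : ∀ x ∈ s, f x ∈ T) : T = ⊤ := by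
  rw [eq_top_iff]
  intro y _
  obtain ⟨x, rfl⟩ := hf y
  have : Algebra.adjoin ℂ s ≤ T.comap f := Algebra.adjoin_le hT
  exact this (hs ▸ Algebra.mem_top)

end Lifting

/-! ### The lens space relations give a spanning family -/

/-- The vectors `A^k z^μ b^ν` with `k > 0` and `B^k z^μ a^ν` with `k ≥ 0`. -/
def lensVector {R : Type*} [Ring R] [StarRing R] (a b z A B : R) :
    (ℕ+ × ℤ × ℤ) ⊕ (ℕ × ℤ × ℤ) → R
  | Sum.inl (k, μ, ν) => A ^ (k : ℕ) * starZPow z μ * starZPow b ν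
  | Sum.inr (k, μ, ν) => B ^ k * starZPow z μ * starZPow a ν

section Span

variable {p q θ : ℝ} {N : ℕ} {R : Type*} [Ring R] [StarRing R] [Algebra ℂ R] [StarModule ℂ R]
  {a b z A B : R}

theorem star_ofReal_smul (r : ℝ) (x : R) : star ((r : ℂ) • x) = (r : ℂ) • star x := by
  rw [star_smul, Complex.star_def, Complex.conj_ofReal]

theorem star_ofReal_pow_smul (r : ℝ) (n : ℕ) (x : R) :
    star ((r : ℂ) ^ n • x) = (r : ℂ) ^ n • star x := by
  rw [← Complex.ofReal_pow, star_ofReal_smul]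

theorem star_phase_smul (t : ℝ) (x : R) : star (phase t • x) = phase (-t) • star x := by
  rw [star_smul, star_phase]

/-! ### Adjoint relations, normality of `A` and normal forms in any *-algebra with the lens
relations. -/

namespace LensRel

variable (h : ∀ x y, LensRel p q θ N a b z A B x y → x = y)
include h

omit [StarModule ℂ R] in
theorem BA_eq : B * A = 0 := by
  have := congrArg star (h _ _ .AB)
  rwa [star_mul, h _ _ .star_A, h _ _ .star_B, star_zero] at this

theorem star_z_A : star z * A = (p : ℂ) • (A * star z) := by
  have := congrArg star (h _ _ .Az)
  rwa [star_mul, star_ofReal_smul, star_mul, h _ _ .star_A] at this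

theorem B_star_z : B * star z = (q : ℂ) • (star z * B) := by
  have := congrArg star (h _ _ .zB)
  rwa [star_mul, star_ofReal_smul, star_mul, h _ _ .star_B] at this

theorem star_a_A : star a * A = (p : ℂ) ^ N • (A * star a) := by
  have := congrArg star (h _ _ .Aa)
  rwa [star_mul, star_ofReal_pow_smul, star_mul, h _ _ .star_A] at this

omit [StarModule ℂ R] in
theorem star_b_A : star b * A = A * star b := by
  have := congrArg star (h _ _ .Ab)
  rwa [star_mul, star_mul, h _ _ .star_A] at this

theorem b_star_z : b * star z = phase (N * 2 * θ) • (star z * b) := by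
  have := congrArg star (h _ _ .zb_star)
  rwa [star_mul, star_phase_smul, star_mul, star_star, neg_neg] at this

/-- The exact error term is irrelevant: lying in `R A`, it vanishes modulo `A R`. -/
theorem a_star_z : ∃ y, a * star z - phase (N * 2 * θ) • (star z * a) = y * A := by
  have := congrArg star (h _ _ .za_star)
  rw [star_sub, star_mul, star_phase_smul, star_mul, star_star, neg_neg, star_smul,
    star_mul _ (star b), star_mul A, h _ _ .star_A, ← mul_assoc] at this
  exact ⟨_, this.trans (smul_mul_assoc _ _ _).symm⟩

theorem b_star_a : b * star a = phase (θ * N * (N - 1)) • star z ^ N := by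
  have := congrArg star (h _ _ .ab_star_eq)
  rwa [star_mul, star_phase_smul, star_star, star_pow, neg_neg] at this

variable (hgen : Algebra.adjoin ℂ {A, B, z, star z, a, star a, b, star b} = ⊤)
include hgen

/-- Each generator passes `A` up to a scalar, except `B`, for which `BA = 0`. This and its adjoint
make `AR` and the annihilator of `A` two-sided, so that both quotients are algebras. -/
theorem exists_mul_A_eq (hp : 0 < p) (x : R) : ∃ y, x * A = A * y := by
  have hp' : (p : ℂ) ≠ 0 := by exact_mod_cast hp.ne'
  have hx : x ∈ Algebra.adjoin ℂ {A, B, z, star z, a, star a, b, star b} :=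
    hgen ▸ Algebra.mem_top
  induction hx using Algebra.adjoin_induction with
  | mem x hx =>
    rcases hx with rfl | rfl | rfl | rfl | rfl | rfl | rfl | rfl
    · exact ⟨_, rfl⟩
    · exact ⟨0, by rw [BA_eq h, mul_zero]⟩
    · exact ⟨_, (qcomm_inv (inv_mul_cancel₀ hp') (h _ _ .Az)).trans (mul_smul_comm _ _ _).symm⟩
    · exact ⟨_, (star_z_A h).trans (mul_smul_comm _ _ _).symm⟩
    · exact ⟨_, (qcomm_inv (inv_mul_cancel₀ (pow_ne_zero N hp')) (h _ _ .Aa)).trans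
        (mul_smul_comm _ _ _).symm⟩
    · exact ⟨_, (star_a_A h).trans (mul_smul_comm _ _ _).symm⟩
    · exact ⟨_, (h _ _ .Ab).symm⟩
    · exact ⟨_, star_b_A h⟩
  | algebraMap c => exact ⟨_, Algebra.commutes c A⟩
  | add x₁ x₂ _ _ h₁ h₂ =>
    obtain ⟨y₁, h₁⟩ := h₁
    obtain ⟨y₂, h₂⟩ := h₂
    exact ⟨y₁ + y₂, by rw [add_mul, h₁, h₂, mul_add]⟩
  | mul x₁ x₂ _ _ h₁ h₂ =>
    obtain ⟨y₁, h₁⟩ := h₁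
    obtain ⟨y₂, h₂⟩ := h₂
    exact ⟨y₁ * y₂, by rw [mul_assoc, h₂, ← mul_assoc, h₁, mul_assoc]⟩

theorem exists_A_mul_eq (hp : 0 < p) (x : R) : ∃ y, A * x = y * A := by
  obtain ⟨y, hy⟩ := exists_mul_A_eq h hgen hp (star x)
  have := congrArg star hy
  rw [star_mul, star_mul, star_star, h _ _ .star_A] at this
  exact ⟨_, this⟩

/-- Every element is, modulo `A R`, a combination of the `B^k z^μ a^ν`. -/
theorem exists_sub_eq_A_mul (hp : 0 < p) (hq : 0 < q) (x : R) :
    ∃ y ∈ Submodule.span ℂ (Set.range fun i : ℕ × ℤ × ℤ =>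
      B ^ i.1 * starZPow z i.2.1 * starZPow a i.2.2), ∃ d, x - y = A * d := by
  have hq' : (q : ℂ) ≠ 0 := by exact_mod_cast hq.ne'
  set I := mulIdeal A (exists_mul_A_eq h hgen hp)
  set π := Ideal.Quotient.mkₐ ℂ I
  have hπ : Function.Surjective π := Ideal.Quotient.mkₐ_surjective ℂ I
  have hA : π A = 0 := Ideal.Quotient.eq_zero_iff_mem.mpr ⟨1, (mul_one A).symm⟩
  -- `Q` has no constant term, so killing `A` makes `ã` unitary.
  have haa : π a * π (star a) = 1 := by
    rw [← map_mul, h _ _ .a_star_a, map_add, map_one, map_qEval, hA, qEval_zero, add_zero]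
  have haa' : π (star a) * π a = 1 := by
    rw [← map_mul, h _ _ .star_a_a, map_add, map_one, map_qEval, hA, qEval_neg_natCast, smul_zero,
      qEval_zero, add_zero]
  let w : (R ⧸ I)ˣ := ⟨π a, π (star a), haa, haa'⟩
  -- Modulo `A` one has `z*z = 1 - B` and `zz* = 1 - qB`, while `zB = qBz` reads `Bz = q⁻¹ zB`; this
  -- fixes `s`, `t` and `r`.
  have hspan := span_orderedMonomial (D := π B) (z := π z) (z' := π (star z)) (w := w)
    (r := (q : ℂ)⁻¹) (s := 1) (t := q) (μ := phase (N * 2 * θ)) (inv_ne_zero hq')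
    (phase_ne_zero _)
    (qcomm_inv (inv_mul_cancel₀ hq') (by rw [← map_mul, h _ _ .zB, map_smul, map_mul]))
    (qcomm_inv (inv_mul_cancel₀ hq') (by rw [← map_mul, B_star_z h, map_smul, map_mul]))
    (by
      rw [← map_mul, h _ _ .star_z_z]
      simp only [map_sub, map_one, map_smul, hA, smul_zero, sub_zero, one_smul])
    (by
      rw [← map_mul, h _ _ .z_star_z]
      simp only [map_sub, map_one, map_smul, hA, sub_zero])
    (by change π B * π a = π a * π B; rw [← map_mul, h _ _ .Ba, map_mul])
    (by change π z * π a = _ • (π a * π z); rw [← map_mul, h _ _ .za, map_smul, map_mul])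
    (by
      obtain ⟨y, hy⟩ := a_star_z h
      have := congrArg π hy
      rw [map_mul, hA, mul_zero, map_sub, sub_eq_zero, map_smul, map_mul, map_mul] at this
      exact qcomm_inv (inv_mul_cancel₀ (phase_ne_zero _)) this)
    (by
      refine subalgebra_eq_top_of_surjective π hπ hgen _ fun x hx => ?_
      set T := Algebra.adjoin ℂ {π B, π z, π (star z), (w : R ⧸ I), ((w⁻¹ : (R ⧸ I)ˣ) : R ⧸ I)}
      have hB : π B ∈ T := Algebra.subset_adjoin (by simp)
      have hz : π z ∈ T := Algebra.subset_adjoin (by simp)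
      have hz' : π (star z) ∈ T := Algebra.subset_adjoin (by simp)
      have ha : π a ∈ T := Algebra.subset_adjoin (show π a ∈ _ by simp [w])
      have ha' : π (star a) ∈ T := Algebra.subset_adjoin (show π (star a) ∈ _ by simp [w])
      rcases hx with rfl | rfl | rfl | rfl | rfl | rfl | rfl | rfl
      · rw [hA]; exact T.zero_mem
      · exact hB
      · exact hz
      · exact hz'
      · exact ha
      · exact ha'
      -- Since `ã` is now invertible and `b̃ ã*` is a multiple of `z*^N`, the generator `b̃` is
      -- redundant.
      · have : π x = π (x * star a) * π a := by rw [map_mul, mul_assoc, haa', mul_one]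
        rw [this, b_star_a h, map_smul, map_pow]
        exact T.mul_mem (T.smul_mem (T.pow_mem hz' _) _) ha
      · have : π (star b) = π (star a) * π (a * star b) := by
          rw [map_mul, ← mul_assoc, haa', one_mul]
        rw [this, h _ _ .ab_star_eq, map_smul, map_pow]
        exact T.mul_mem ha' (T.smul_mem (T.pow_mem hz _) _))
  obtain ⟨y, hy, hxy⟩ := exists_mem_span_map_eq π (v := fun i : ℕ × ℤ × ℤ =>
      B ^ i.1 * starZPow z i.2.1 * starZPow a i.2.2) (fun i => by
    rw [orderedMonomial, ← pairZPow_units, starZPow_eq_pairZPow, starZPow_eq_pairZPow, map_mul,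
      map_mul, map_pow, map_pairZPow, map_pairZPow]
    rfl) hspan x
  exact ⟨y, hy, Ideal.Quotient.eq.mp hxy.symm⟩

/-- Every element of `A R` is a combination of the `A^k z^μ b^ν` with `k > 0`. -/
theorem A_mul_mem_span (hp : 0 < p) (x : R) :
    A * x ∈ Submodule.span ℂ (Set.range fun i : ℕ × ℤ × ℤ =>
      A ^ (i.1 + 1) * starZPow z i.2.1 * starZPow b i.2.2) := by
  have hp' : (p : ℂ) ≠ 0 := by exact_mod_cast hp.ne'
  -- The product `A x` depends only on the class of `x` modulo the annihilator of `A`, so normal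
  -- ordering may be done in that quotient, where `AB = 0` makes `B` vanish.
  set I := annIdeal A (exists_A_mul_eq h hgen hp)
  set π := Ideal.Quotient.mkₐ ℂ I
  have hπ : Function.Surjective π := Ideal.Quotient.mkₐ_surjective ℂ I
  have hB : π B = 0 := Ideal.Quotient.eq_zero_iff_mem.mpr (h _ _ .AB)
  have hbb : π b * π (star b) = 1 := by
    rw [← map_mul, h _ _ .b_star_b, map_add, map_one, map_qEval, hB, qEval_zero, add_zero]
  have hbb' : π (star b) * π b = 1 := by
    rw [← map_mul, h _ _ .star_b_b, map_add, map_one, map_qEval, hB, qEval_neg_natCast, smul_zero,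
      qEval_zero, add_zero]
  let w : (R ⧸ I)ˣ := ⟨π b, π (star b), hbb, hbb'⟩
  have hspan := span_orderedMonomial (D := π A) (z := π z) (z' := π (star z)) (w := w)
    (r := p) (s := p) (t := 1) (μ := phase (N * 2 * θ)) hp' (phase_ne_zero _)
    (by rw [← map_mul, h _ _ .Az, map_smul, map_mul])
    (by rw [← map_mul, star_z_A h, map_smul, map_mul])
    (by
      rw [← map_mul, h _ _ .star_z_z]
      simp only [map_sub, map_one, map_smul, hB, sub_zero])
    (by
      rw [← map_mul, h _ _ .z_star_z]
      simp only [map_sub, map_one, map_smul, hB, smul_zero, sub_zero, one_smul])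
    (by change π A * π b = π b * π A; rw [← map_mul, h _ _ .Ab, map_mul])
    (by
      change π z * π b = _ • (π b * π z)
      have := congrArg π (h _ _ .zb)
      rwa [map_smul, map_mul, map_mul, hB, zero_mul, zero_mul, smul_zero, map_sub, sub_eq_zero,
        map_smul, map_mul, map_mul] at this)
    (by
      have := congrArg π (b_star_z h)
      rw [map_smul, map_mul, map_mul] at this
      exact qcomm_inv (inv_mul_cancel₀ (phase_ne_zero _)) this)
    (by
      refine subalgebra_eq_top_of_surjective π hπ hgen _ fun x hx => ?_
      set T := Algebra.adjoin ℂ {π A, π z, π (star z), (w : R ⧸ I), ((w⁻¹ : (R ⧸ I)ˣ) : R ⧸ I)}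
      have hA : π A ∈ T := Algebra.subset_adjoin (by simp)
      have hz : π z ∈ T := Algebra.subset_adjoin (by simp)
      have hz' : π (star z) ∈ T := Algebra.subset_adjoin (by simp)
      have hb : π b ∈ T := Algebra.subset_adjoin (show π b ∈ _ by simp [w])
      have hb' : π (star b) ∈ T := Algebra.subset_adjoin (show π (star b) ∈ _ by simp [w])
      rcases hx with rfl | rfl | rfl | rfl | rfl | rfl | rfl | rfl
      · exact hA
      · rw [hB]; exact T.zero_mem
      · exact hz
      · exact hz'
      · have : π x = π (x * star b) * π b := by rw [map_mul, mul_assoc, hbb', mul_one]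
        rw [this, h _ _ .ab_star_eq, map_smul, map_pow]
        exact T.mul_mem (T.smul_mem (T.pow_mem hz _) _) hb
      · have : π (star a) = π (star b) * π (b * star a) := by
          rw [map_mul, ← mul_assoc, hbb', one_mul]
        rw [this, b_star_a h, map_smul, map_pow]
        exact T.mul_mem hb' (T.smul_mem (T.pow_mem hz' _) _)
      · exact hb
      · exact hb')
  obtain ⟨y, hy, hxy⟩ := exists_mem_span_map_eq π (v := fun i : ℕ × ℤ × ℤ =>
      A ^ i.1 * starZPow z i.2.1 * starZPow b i.2.2) (fun i => by
    rw [orderedMonomial, ← pairZPow_units, starZPow_eq_pairZPow, starZPow_eq_pairZPow, map_mul,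
      map_mul, map_pow, map_pairZPow, map_pairZPow]
    rfl) hspan x
  have hAxy : A * (x - y) = 0 := Ideal.Quotient.eq.mp hxy.symm
  rw [mul_sub, sub_eq_zero] at hAxy
  rw [hAxy]
  have hle : Submodule.span ℂ (Set.range fun i : ℕ × ℤ × ℤ =>
      A ^ i.1 * starZPow z i.2.1 * starZPow b i.2.2) ≤
      (Submodule.span ℂ (Set.range fun i : ℕ × ℤ × ℤ =>
        A ^ (i.1 + 1) * starZPow z i.2.1 * starZPow b i.2.2)).comap (LinearMap.mulLeft ℂ A) := by
    rw [Submodule.span_le]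
    rintro _ ⟨i, rfl⟩
    refine Submodule.subset_span ⟨i, ?_⟩
    simp only [LinearMap.mulLeft_apply, pow_succ', mul_assoc]
  exact hle hy

/-- The normal forms of `R / AR` and of `AR` add up. The statement for general `R` is applied to the
universal algebra and, with `N = 1`, to the sphere. -/
theorem span_lensVector (hp : 0 < p) (hq : 0 < q) :
    Submodule.span ℂ (Set.range (lensVector a b z A B)) = ⊤ := by
  rw [eq_top_iff]
  intro x _
  obtain ⟨y, hy, d, hd⟩ := exists_sub_eq_A_mul h hgen hp hq x
  rw [show x = y + A * d by rw [← hd, add_sub_cancel]]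
  refine Submodule.add_mem _ (Submodule.span_mono ?_ hy)
    (Submodule.span_mono ?_ (A_mul_mem_span h hgen hp d))
  · rintro _ ⟨⟨k, i, j⟩, rfl⟩
    exact ⟨Sum.inr (k, i, j), rfl⟩
  · rintro _ ⟨⟨k, i, j⟩, rfl⟩
    exact ⟨Sum.inl (k.succPNat, i, j), rfl⟩

end LensRel

end Span

/-! ### The lens space relations in the Heegaard quantum sphere -/

namespace SphereRel

variable {p q θ : ℝ} {N : ℕ} {R : Type*} [Ring R] [StarRing R] [Algebra ℂ R] [StarModule ℂ R]
  {a b A B : R}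

theorem phase_cancel (t : ℝ) : phase (-t) * phase t = 1 := by
  rw [← phase_add]; simp

/-! ### Commutation rules and products of powers in the sphere. -/

section Basic

variable (h : ∀ x y, SphereRel p q θ a b x y → x = y)
include h

theorem b_star_a : b * star a = phase (2 * θ) • (star a * b) := by
  have := congrArg star (h _ _ .ab_star)
  rwa [star_mul, star_phase_smul, star_mul, star_star, neg_neg] at this

theorem star_b_star_a : star b * star a = phase (-(2 * θ)) • (star a * star b) := by
  have := congrArg star (h _ _ .ab)
  rwa [star_mul, star_phase_smul, star_mul] at this

theorem star_a_b : star a * b = phase (-(2 * θ)) • (b * star a) :=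
  qcomm_inv (phase_cancel _) (b_star_a h)

theorem star_a_star_b : star a * star b = phase (2 * θ) • (star b * star a) :=
  qcomm_inv (phase_mul_phase_neg _) (star_b_star_a h)

omit [StarModule ℂ R] in
theorem b_a : b * a = phase (-(2 * θ)) • (a * b) :=
  qcomm_inv (phase_cancel _) (h _ _ .ab)

omit [StarModule ℂ R] in
theorem star_b_a : star b * a = phase (2 * θ) • (a * star b) :=
  qcomm_inv (phase_mul_phase_neg _) (h _ _ .ab_star)

/-- Exchanging the two generators. -/
theorem swap : ∀ x y, SphereRel q p (-θ) b a x y → x = y := by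
  intro x y hxy
  cases hxy with
  | ab => rw [b_a h]; congr 2; ring
  | ab_star => rw [b_star_a h]; congr 2; ring
  | disc_a => exact h _ _ .disc_b
  | disc_b => exact h _ _ .disc_a
  | mul_zero =>
    have := congrArg star (h _ _ .mul_zero)
    simpa using this

variable (hA : A = 1 - a * star a)
include hA

omit [StarModule ℂ R] [Algebra ℂ R] h in
theorem star_A : star A = A := by
  rw [hA]; simp

omit [StarModule ℂ R] [Algebra ℂ R] h in
theorem a_star_a : a * star a = 1 - A := by
  rw [hA]; simp

omit [StarModule ℂ R] in
theorem star_a_a : star a * a = 1 - (p : ℂ) • A := by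
  have := h _ _ .disc_a
  rw [sub_eq_iff_eq_add] at this
  rw [this, hA, map_sub, map_one, smul_sub, Algebra.algebraMap_eq_smul_one]
  abel

omit [StarModule ℂ R] in
theorem A_a : A * a = (p : ℂ) • (a * A) := by
  have h1 : A * a = a * (1 - star a * a) := by rw [hA]; noncomm_ring
  rw [h1, star_a_a h hA, sub_sub_cancel, mul_smul_comm]

theorem star_a_A : star a * A = (p : ℂ) • (A * star a) := by
  have := congrArg star (A_a h hA)
  rwa [star_mul, star_ofReal_smul, star_mul, star_A hA] at this

theorem A_b : A * b = b * A := by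
  have h1 : a * star a * b = b * (a * star a) := by
    rw [mul_assoc, star_a_b h, mul_smul_comm, ← mul_assoc, h _ _ .ab, smul_mul_assoc, smul_smul,
      phase_cancel, one_smul, mul_assoc]
  rw [hA, sub_mul, mul_sub, h1, one_mul, mul_one]

theorem A_star_b : A * star b = star b * A := by
  have := congrArg star (A_b h hA)
  rw [star_mul, star_mul, star_A hA] at this
  exact this.symm

omit [StarModule ℂ R] in
-- The innermost `a a*` is `1 - A`, and moving this `A` left past `a^n` costs `p^{-n}`; each step
-- thus contributes the factor `1 - p^{-n} A`.
theorem a_pow_mul_star_pow (hp : 0 < p) (n : ℕ) : a ^ n * star a ^ n = 1 + qEval p n A := by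
  have hp' : (p : ℂ) ≠ 0 := by exact_mod_cast hp.ne'
  refine eq_one_add_qEval hp A (fun n => a ^ n * star a ^ n) (by simp) (fun n => ?_) n
  have h1 := qcomm_pow_left (qcomm_inv (inv_mul_cancel₀ hp') (A_a h hA)) n
  calc a ^ (n + 1) * star a ^ (n + 1) = a ^ n * (a * star a) * star a ^ n := by
        rw [pow_succ a, pow_succ' (star a)]; simp only [mul_assoc]
    _ = a ^ n * star a ^ n - a ^ n * A * star a ^ n := by
        rw [a_star_a hA]; noncomm_ring
    _ = _ := by
        rw [h1, sub_mul, one_mul, smul_mul_assoc, smul_mul_assoc, mul_assoc]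

/-- Here the innermost factor is `1 - pA`, and passing `a*^n` costs `p^n`, which is the same
recursion with base `p⁻¹` at `pA`. -/
theorem star_pow_mul_a_pow (hp : 0 < p) (n : ℕ) :
    star a ^ n * a ^ n = 1 + qEval p (-(n : ℤ)) A := by
  rw [qEval_neg_natCast]
  refine eq_one_add_qEval (inv_pos.mpr hp) _ (fun n => star a ^ n * a ^ n) (by simp)
    (fun n => ?_) n
  have h1 := qcomm_pow_left (star_a_A h hA) n
  calc star a ^ (n + 1) * a ^ (n + 1) = star a ^ n * (star a * a) * a ^ n := by
        rw [pow_succ (star a), pow_succ' a]; simp only [mul_assoc]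
    _ = star a ^ n * a ^ n - (p : ℂ) • (star a ^ n * A * a ^ n) := by
        rw [star_a_a h hA, mul_sub, sub_mul, mul_one, mul_smul_comm, smul_mul_assoc]
    _ = _ := by
        rw [h1, smul_mul_assoc, mul_assoc, smul_smul, smul_smul, sub_mul, one_mul, smul_mul_assoc]
        congr 2
        push_cast
        rw [inv_inv, mul_comm]

variable (hB : B = 1 - b * star b)
include hB

omit [StarModule ℂ R] in
theorem A_B : A * B = 0 := by
  rw [hA, hB]; exact h _ _ .mul_zero

theorem B_A : B * A = 0 := A_B (swap h) hB hA

/-- Next to `A` the generator `b` behaves as a unitary: `bb* = 1 - B`, `A` commutes with `b`, and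
`AB = 0`. -/
theorem A_b_pow_star_pow (n : ℕ) : A * (b ^ n * star b ^ n) = A := by
  induction n with
  | zero => simp
  | succ n ih =>
    have hb : A * b ^ n = b ^ n * A := ((show Commute A b from A_b h hA).pow_right n).eq
    calc A * (b ^ (n + 1) * star b ^ (n + 1)) = A * b ^ n * (b * star b) * star b ^ n := by
          rw [pow_succ b, pow_succ' (star b)]; simp only [mul_assoc]
      _ = A * (b ^ n * star b ^ n) - b ^ n * (A * B) * star b ^ n := by
          rw [a_star_a hB, ← mul_assoc (b ^ n) A, ← hb]; noncomm_ring
      _ = A := by rw [ih, A_B h hA hB]; simp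

theorem A_star_pow_b_pow (n : ℕ) : A * (star b ^ n * b ^ n) = A := by
  induction n with
  | zero => simp
  | succ n ih =>
    have hb : A * star b ^ n = star b ^ n * A :=
      ((show Commute A (star b) from A_star_b h hA).pow_right n).eq
    calc A * (star b ^ (n + 1) * b ^ (n + 1)) = A * star b ^ n * (star b * b) * b ^ n := by
          rw [pow_succ (star b), pow_succ' b]; simp only [mul_assoc]
      _ = A * (star b ^ n * b ^ n) - (q : ℂ) • (star b ^ n * (A * B) * b ^ n) := by
          rw [star_a_a (swap h) hB, ← mul_assoc (star b ^ n) A, ← hb, mul_sub, sub_mul, mul_one,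
            mul_smul_comm, smul_mul_assoc, mul_assoc]
      _ = A := by rw [ih, A_B h hA hB]; simp

end Basic

/-! ### Verification of the lens relations in the sphere. -/

section Lens

variable (h : ∀ x y, SphereRel p q θ a b x y → x = y)
  (hA : A = 1 - a * star a) (hB : B = 1 - b * star b)
include h

omit [StarModule ℂ R] in
theorem z_pow (n : ℕ) :
    (a * star b) ^ n = phase (θ * n * (n - 1)) • (a ^ n * star b ^ n) := by
  exact mul_pow_of_qcomm (star_b_a h) n

theorem star_z_pow (n : ℕ) :
    star (a * star b) ^ n = phase (-(θ * n * (n - 1))) • (b ^ n * star a ^ n) := by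
  rw [star_mul, star_star, mul_pow_of_qcomm (s := -θ) (by rw [star_a_b h]; congr 2; ring)]
  congr 2; ring

include hA hB

theorem star_z_mul_z : star (a * star b) * (a * star b) = 1 - (p : ℂ) • A - B := by
  have h1 : star a * a * star b = star b * (star a * a) := by
    rw [star_a_a h hA, sub_mul, mul_sub, smul_mul_assoc, mul_smul_comm, A_star_b h hA, one_mul,
      mul_one]
  calc star (a * star b) * (a * star b) = b * (star a * a * star b) := by
        rw [star_mul, star_star]; simp only [mul_assoc]
    _ = (1 - B) * (1 - (p : ℂ) • A) := by
        rw [h1, ← mul_assoc, a_star_a hB, star_a_a h hA]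
    _ = 1 - (p : ℂ) • A - B := by
        rw [sub_mul, one_mul, mul_sub, mul_one, mul_smul_comm, B_A h hA hB, smul_zero, sub_zero]

theorem z_mul_star_z : (a * star b) * star (a * star b) = 1 - A - (q : ℂ) • B := by
  have h1 : a * (star b * b) = star b * b * a := by
    rw [star_a_a (swap h) hB, sub_mul, mul_sub, smul_mul_assoc, mul_smul_comm, A_b (swap h) hB,
      one_mul, mul_one]
  calc (a * star b) * star (a * star b) = a * (star b * b) * star a := by
        rw [star_mul, star_star]; simp only [mul_assoc]
    _ = (1 - (q : ℂ) • B) * (1 - A) := by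
        rw [h1, mul_assoc, a_star_a hA, star_a_a (swap h) hB]
    _ = 1 - A - (q : ℂ) • B := by
        rw [sub_mul, one_mul, mul_sub, mul_one, smul_mul_assoc, B_A h hA hB, smul_zero, sub_zero]

/-- This evaluates the right side of the relation for `z ã*` with `N = n + 1`: beside `A` the powers
of `b` and `b*` cancel, up to one `b*`. `B_star_z_pow_mul` is the mirror image for `z b̃`. -/
theorem A_star_z_pow_mul (n : ℕ) :
    A * star (a * star b) ^ n * star b ^ (n + 1) =
      phase (θ * (n + 1) * n) • (A * star a ^ n * star b) := by
  have h1 : star a ^ n * star b ^ (n + 1) =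
      phase (2 * θ) ^ (n * (n + 1)) • (star b ^ (n + 1) * star a ^ n) :=
    qcomm_pow_pow (star_a_star_b h) n (n + 1)
  have h2 : star b * star a ^ n = phase (-(2 * θ)) ^ n • (star a ^ n * star b) :=
    qcomm_pow_right (star_b_star_a h) n
  have h3 : A * b ^ n * star b ^ (n + 1) * star a ^ n =
      A * (b ^ n * star b ^ n) * (star b * star a ^ n) := by
    rw [pow_succ]; simp only [mul_assoc]
  calc A * star (a * star b) ^ n * star b ^ (n + 1)
      = phase (-(θ * n * (n - 1))) • (A * b ^ n * (star a ^ n * star b ^ (n + 1))) := by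
        rw [star_z_pow h, mul_smul_comm, smul_mul_assoc]; simp only [mul_assoc]
    _ = _ := by
        rw [h1, mul_smul_comm, ← mul_assoc, h3, A_b_pow_star_pow h hA hB, h2, mul_smul_comm,
          smul_smul, smul_smul, phase_pow, phase_pow, ← phase_add, ← phase_add, ← mul_assoc A]
        congr 2; push_cast; ring

theorem B_star_z_pow_mul (n : ℕ) :
    B * star (a * star b) ^ n * a ^ (n + 1) =
      phase (-(θ * (n + 1) * n)) • (B * a * b ^ n) := by
  have h0 : b ^ n * a = phase (-(2 * θ)) ^ n • (a * b ^ n) := qcomm_pow_left (b_a h) n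
  have h1 : B * b ^ n = (q : ℂ) ^ n • (b ^ n * B) := qcomm_pow_right (A_a (swap h) hB) n
  have h2 : b ^ n * star a ^ n * a ^ (n + 1) = b ^ n * (star a ^ n * a ^ n) * a := by
    rw [pow_succ]; simp only [mul_assoc]
  have h3 : B * b ^ n * (star a ^ n * a ^ n) = B * b ^ n := by
    rw [h1, smul_mul_assoc, mul_assoc, A_star_pow_b_pow (swap h) hB hA]
  calc B * star (a * star b) ^ n * a ^ (n + 1)
      = phase (-(θ * n * (n - 1))) • (B * b ^ n * (star a ^ n * a ^ n) * a) := by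
        rw [star_z_pow h, mul_smul_comm, smul_mul_assoc, mul_assoc B, h2]; simp only [mul_assoc]
    _ = phase (-(θ * n * (n - 1))) • (B * (b ^ n * a)) := by
        rw [h3, mul_assoc B (b ^ n) a]
    _ = _ := by
        rw [h0, mul_smul_comm, smul_smul, phase_pow, ← phase_add, ← mul_assoc B]
        congr 2; ring

theorem lensRel (hp : 0 < p) (hq : 0 < q) (hN : 0 < N) {x y : R}
    (hxy : LensRel p q θ N (a ^ N) (b ^ N) (a * star b) A B x y) : x = y := by
  have hp' : (p : ℂ) ≠ 0 := by exact_mod_cast hp.ne'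
  have hq' : (q : ℂ) ≠ 0 := by exact_mod_cast hq.ne'
  have h' := swap h
  cases hxy with
  | star_A => exact star_A hA
  | star_B => exact star_A hB
  | AB => exact A_B h hA hB
  | Az =>
    rw [← mul_assoc, A_a h hA, smul_mul_assoc, mul_assoc, A_star_b h hA, mul_assoc]
  | zB =>
    rw [mul_assoc, star_a_A h' hB, mul_smul_comm, ← mul_assoc, ← A_b h' hB, mul_assoc]
  | star_z_z => exact star_z_mul_z h hA hB
  | z_star_z => exact z_mul_star_z h hA hB
  | Aa => exact qcomm_pow_right (A_a h hA) N
  | Ab => exact ((show Commute A b from A_b h hA).pow_right N).eq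
  | Ba => exact ((show Commute B a from A_b h' hB).pow_right N).eq
  | Bb => exact qcomm_pow_right (A_a h' hB) N
  | za =>
    rw [mul_assoc, qcomm_pow_right (star_b_a h) N, mul_smul_comm, ← mul_assoc, ← mul_assoc,
      ← pow_succ, ← pow_succ', phase_pow]
    congr 2; ring
  | zb_star =>
    rw [star_pow, mul_assoc, ← pow_succ', pow_succ, ← mul_assoc,
      qcomm_pow_right (h _ _ .ab_star) N, smul_mul_assoc, mul_assoc, phase_pow]
    congr 2; ring
  | za_star =>
    -- With `N = n + 1` the exponent `1 - N` is `-n`, so `z^{1-N}` is `z*^n`.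
    obtain ⟨n, rfl⟩ := Nat.exists_eq_add_of_lt hN
    rw [zero_add]
    have e : (1 : ℤ) - ((n + 1 : ℕ) : ℤ) = -(n : ℤ) := by push_cast; ring
    rw [e, starZPow_eq_pairZPow, pairZPow_neg_natCast, star_pow, star_pow,
      A_star_z_pow_mul h hA hB, smul_smul]
    have h1 := qcomm_pow_right (star_b_star_a h) (n + 1)
    have h2 := qcomm_pow_left (star_a_A h hA) n
    -- The two orders of `a` and `a*^N` differ by `(p^N - 1) A a*^n`, the source of the coefficient
    -- in the relation.
    have h3 : a * star a ^ (n + 1) = star a ^ n - A * star a ^ n := by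
      rw [pow_succ', ← mul_assoc, a_star_a hA, sub_mul, one_mul]
    have h4 : star a ^ (n + 1) * a = star a ^ n - (p : ℂ) ^ (n + 1) • (A * star a ^ n) := by
      rw [pow_succ, mul_assoc, star_a_a h hA, mul_sub, mul_one, mul_smul_comm, h2, smul_smul,
        pow_succ']
    rw [mul_assoc a, h1, mul_smul_comm, ← mul_assoc, ← mul_assoc (star a ^ (n + 1)), h3, h4,
      phase_pow]
    have e1 : phase (-(((n + 1 : ℕ) : ℝ) * (((n + 1 : ℕ) : ℝ) + 1) * θ)) *
        ((p : ℂ) ^ (n + 1) - 1) * phase (θ * (n + 1) * n) =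
        phase (-(((n + 1 : ℕ) : ℝ) * 2 * θ)) * ((p : ℂ) ^ (n + 1) - 1) := by
      rw [mul_right_comm, ← phase_add]; congr 2; push_cast; ring
    have e2 : ((n + 1 : ℕ) : ℝ) * -(2 * θ) = -(((n + 1 : ℕ) : ℝ) * 2 * θ) := by ring
    rw [e1, e2, sub_mul, sub_mul, smul_mul_assoc]
    module
  | zb =>
    obtain ⟨n, rfl⟩ := Nat.exists_eq_add_of_lt hN
    rw [zero_add]
    have e : (1 : ℤ) - ((n + 1 : ℕ) : ℤ) = -(n : ℤ) := by push_cast; ring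
    rw [e, starZPow_eq_pairZPow, pairZPow_neg_natCast, B_star_z_pow_mul h hA hB, smul_smul]
    have h1 := qcomm_pow_right (h _ _ .ab) (n + 1)
    have h2 := qcomm_pow_left (qcomm_inv (inv_mul_cancel₀ hq') (A_a h' hB)) n
    -- Here the two orders differ by `(q^{-n} - q) B b^n`, and `q^{-n} - q = q (q^{-N} - 1)`.
    have h3 : star b * b ^ (n + 1) = b ^ n - (q : ℂ) • (B * b ^ n) := by
      rw [pow_succ', ← mul_assoc, star_a_a h' hB, sub_mul, one_mul, smul_mul_assoc]
    have h4 : b ^ (n + 1) * star b = b ^ n - (q : ℂ)⁻¹ ^ n • (B * b ^ n) := by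
      rw [pow_succ, mul_assoc, a_star_a hB, mul_sub, mul_one, h2]
    have h5 : b ^ (n + 1) * (a * star b) =
        phase (-(((n + 1 : ℕ) : ℝ) * 2 * θ)) • (a * (b ^ (n + 1) * star b)) := by
      rw [← mul_assoc, qcomm_pow_left (b_a h) (n + 1), smul_mul_assoc, mul_assoc, phase_pow]
      congr 2; ring
    have e1 : phase (θ * ((n + 1 : ℕ) : ℝ) * (((n + 1 : ℕ) : ℝ) - 1)) *
        ((q : ℂ) * ((q : ℂ) ^ (-((n + 1 : ℕ) : ℤ)) - 1)) * phase (-(θ * (n + 1) * n)) =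
        (q : ℂ)⁻¹ ^ n - q := by
      rw [mul_right_comm, ← phase_add]
      have : θ * ((n + 1 : ℕ) : ℝ) * (((n + 1 : ℕ) : ℝ) - 1) + -(θ * (n + 1) * n) = 0 := by
        push_cast; ring
      have hqn : (q : ℂ) * ((q : ℂ) ^ (n + 1))⁻¹ = (q : ℂ)⁻¹ ^ n := by
        rw [pow_succ', mul_inv, ← mul_assoc, mul_inv_cancel₀ hq', one_mul, inv_pow]
      rw [this, phase_zero, one_mul, zpow_neg, zpow_natCast, mul_sub, hqn, mul_one]
    rw [e1, h5, smul_smul, phase_mul_phase_neg, one_smul, mul_assoc, h3, h4, A_b h' hB, mul_sub,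
      mul_sub, mul_smul_comm, mul_smul_comm, mul_assoc]
    module
  | ab =>
    rw [qcomm_pow_pow (h _ _ .ab) N N, phase_pow]
    congr 2; push_cast; ring
  | ab_star =>
    rw [star_pow, qcomm_pow_pow (h _ _ .ab_star) N N, phase_pow]
    congr 2; push_cast; ring
  | ab_star_eq =>
    rw [z_pow h, smul_smul, phase_cancel, one_smul, star_pow]
  | star_a_a => rw [star_pow]; exact star_pow_mul_a_pow h hA hp N
  | a_star_a => rw [star_pow]; exact a_pow_mul_star_pow h hA hp N
  | star_b_b => rw [star_pow]; exact star_pow_mul_a_pow h' hB hq N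
  | b_star_b => rw [star_pow]; exact a_pow_mul_star_pow h' hB hq N

end Lens

end SphereRel

/-! ### Representations of the Heegaard quantum sphere by weighted shifts -/

/-- Algebra homomorphisms out of the Heegaard quantum sphere, into an algebra without a `*`. -/
theorem exists_algHom_sphere {p q θ : ℝ} {S : Type*} [Ring S] [Algebra ℂ S] (a a' b b' : S)
    (hab : a * b = phase (2 * θ) • (b * a)) (hab' : a * b' = phase (-(2 * θ)) • (b' * a))
    (hb'a' : b' * a' = phase (-(2 * θ)) • (a' * b')) (hba' : b * a' = phase (2 * θ) • (a' * b))
    (ha : a' * a - (p : ℂ) • (a * a') = algebraMap ℂ S (1 - p))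
    (hb : b' * b - (q : ℂ) • (b * b') = algebraMap ℂ S (1 - q))
    (h0 : (1 - a * a') * (1 - b * b') = 0) (h0' : (1 - b * b') * (1 - a * a') = 0) :
    ∃ π : Sphere p q θ →ₐ[ℂ] S, π (Sphere.a p q θ) = a ∧ π (star (Sphere.a p q θ)) = a' ∧
      π (Sphere.b p q θ) = b ∧ π (star (Sphere.b p q θ)) = b' := by
  let g : FreeStarAlgebra SphereGen →ₐ[ℂ] S := FreeAlgebra.lift ℂ (Sum.elim
    (fun x => SphereGen.casesOn x a b) (fun x => SphereGen.casesOn x a' b'))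
  have ga : g (FreeStarAlgebra.gen .a) = a := FreeAlgebra.lift_ι_apply _ _
  have gb : g (FreeStarAlgebra.gen .b) = b := FreeAlgebra.lift_ι_apply _ _
  have ga' : g (star (FreeStarAlgebra.gen .a)) = a' := by
    rw [FreeStarAlgebra.gen, FreeStarAlgebra.star_letter]; exact FreeAlgebra.lift_ι_apply _ _
  have gb' : g (star (FreeStarAlgebra.gen .b)) = b' := by
    rw [FreeStarAlgebra.gen, FreeStarAlgebra.star_letter]; exact FreeAlgebra.lift_ι_apply _ _
  have key : ∀ ⦃x y⦄, StarClosure (SphereRel p q θ (FreeStarAlgebra.gen SphereGen.a)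
      (FreeStarAlgebra.gen SphereGen.b)) x y → g x = g y := by
    intro x y hxy
    cases hxy with
    | of hxy =>
      cases hxy with
      | ab => rw [map_mul, map_smul, map_mul, ga, gb, hab]
      | ab_star => rw [map_mul, map_smul, map_mul, ga, gb', hab']
      | disc_a => rw [map_sub, map_mul, map_smul, map_mul, ga, ga', ha, AlgHom.commutes]
      | disc_b => rw [map_sub, map_mul, map_smul, map_mul, gb, gb', hb, AlgHom.commutes]
      | mul_zero =>
        rw [map_mul, map_sub, map_sub, map_mul, map_mul, ga, ga', gb, gb', map_one, h0, map_zero]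
    -- As `S` has no star, the adjoint relations are checked from their own hypotheses; the disc
    -- relations are self-adjoint.
    | star hxy =>
      cases hxy with
      | ab =>
        rw [star_mul, star_phase_smul, star_mul, map_mul, map_smul, map_mul, ga', gb', hb'a']
      | ab_star =>
        rw [star_mul, star_phase_smul, star_mul, star_star, map_mul, map_smul, map_mul, ga', gb,
          hba', neg_neg]
      | disc_a =>
        rw [star_sub, star_mul, star_ofReal_smul, star_mul, star_star,
          FreeStarAlgebra.star_algebraMap, map_sub, map_mul, map_smul, map_mul, ga, ga', ha, AlgHom.commutes]
        simp
      | disc_b =>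
        rw [star_sub, star_mul, star_ofReal_smul, star_mul, star_star,
          FreeStarAlgebra.star_algebraMap, map_sub, map_mul, map_smul, map_mul, gb, gb', hb, AlgHom.commutes]
        simp
      | mul_zero =>
        rw [star_mul, star_sub, star_sub, star_mul, star_mul, star_star, star_star, star_one,
          map_mul, map_sub, map_sub, map_mul, map_mul, ga, ga', gb, gb', map_one, h0', star_zero,
          map_zero]
  let π : Sphere p q θ →ₐ[ℂ] S := RingQuot.liftAlgHom ℂ ⟨g, key⟩
  have hπ : ∀ x, π (UniversalStarAlgebra.mk x) = g x := fun x =>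
    RingQuot.liftAlgHom_mkAlgHom_apply ℂ g key x
  refine ⟨π, ?_, ?_, ?_, ?_⟩
  · exact (hπ _).trans ga
  · rw [Sphere.a, UniversalStarAlgebra.gen, ← map_star]; exact (hπ _).trans ga'
  · exact (hπ _).trans gb
  · rw [Sphere.b, UniversalStarAlgebra.gen, ← map_star, ← gb']; exact hπ _

/-- The operator `f ↦ ((n, l) ↦ c n * f (n - i, l - j))`. -/
def weightedShift (c : ℤ → ℂ) (i j : ℤ) : Module.End ℂ (ℤ × ℤ → ℂ) where
  toFun f x := c x.1 * f (x.1 - i, x.2 - j)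
  map_add' f g := by ext x; simp [mul_add]
  map_smul' t f := by ext x; simp [mul_left_comm]

@[simp] theorem weightedShift_apply (c : ℤ → ℂ) (i j : ℤ) (f : ℤ × ℤ → ℂ) (x : ℤ × ℤ) :
    weightedShift c i j f x = c x.1 * f (x.1 - i, x.2 - j) := rfl

theorem weightedShift_mul (c d : ℤ → ℂ) (i j i' j' : ℤ) :
    weightedShift c i j * weightedShift d i' j' =
      weightedShift (fun n => c n * d (n - i)) (i + i') (j + j') := by
  ext f x
  simp [mul_assoc, sub_sub]

theorem weightedShift_smul (t : ℂ) (c : ℤ → ℂ) (i j : ℤ) :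
    t • weightedShift c i j = weightedShift (fun n => t * c n) i j := by
  ext f x
  simp [mul_assoc]

theorem weightedShift_sub (c d : ℤ → ℂ) (i j : ℤ) :
    weightedShift c i j - weightedShift d i j = weightedShift (fun n => c n - d n) i j := by
  ext f x
  simp [sub_mul]

theorem one_eq_weightedShift : (1 : Module.End ℂ (ℤ × ℤ → ℂ)) = weightedShift 1 0 0 := by
  ext f x
  simp

theorem algebraMap_eq_weightedShift (t : ℂ) :
    algebraMap ℂ (Module.End ℂ (ℤ × ℤ → ℂ)) t = weightedShift (fun _ => t) 0 0 := by
  ext f x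
  simp

theorem weightedShift_pow (r : ℂ) (k : ℕ) :
    weightedShift (fun n => r ^ n) 0 0 ^ k = weightedShift (fun n => (r ^ k) ^ n) 0 0 := by
  induction k with
  | zero => simp [one_eq_weightedShift]; rfl
  | succ k ih =>
    rw [pow_succ, ih, weightedShift_mul]
    congr 1
    funext n
    rw [sub_zero, pow_succ, mul_zpow]

/-- Weighted shifts by `(i, j)` whose weights do not vanish far out. -/
def IsEventualShift (T : Module.End ℂ (ℤ × ℤ → ℂ)) (s : ℤ × ℤ) : Prop :=
  ∃ c : ℤ → ℂ, (∀ᶠ n in Filter.atTop, c n ≠ 0) ∧ T = weightedShift c s.1 s.2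

namespace IsEventualShift

theorem one : IsEventualShift 1 0 := ⟨1, by simp, one_eq_weightedShift⟩

theorem mul {T T' : Module.End ℂ (ℤ × ℤ → ℂ)} {s s' : ℤ × ℤ} (h : IsEventualShift T s)
    (h' : IsEventualShift T' s') : IsEventualShift (T * T') (s + s') := by
  obtain ⟨c, hc, rfl⟩ := h
  obtain ⟨d, hd, rfl⟩ := h'
  refine ⟨_, ?_, weightedShift_mul _ _ _ _ _ _⟩
  have : Filter.Tendsto (fun n : ℤ => n - s.1) Filter.atTop Filter.atTop :=
    Filter.tendsto_atTop_add_const_right _ _ Filter.tendsto_id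
  filter_upwards [hc, this.eventually hd] with n h1 h2 using mul_ne_zero h1 h2

theorem pow {T : Module.End ℂ (ℤ × ℤ → ℂ)} {s : ℤ × ℤ} (h : IsEventualShift T s) (n : ℕ) :
    IsEventualShift (T ^ n) (n • s) := by
  induction n with
  | zero => simpa using one
  | succ n ih => rw [pow_succ, succ_nsmul]; exact ih.mul h

theorem pairZPow {T T' : Module.End ℂ (ℤ × ℤ → ℂ)} {s : ℤ × ℤ} (h : IsEventualShift T s)
    (h' : IsEventualShift T' (-s)) (μ : ℤ) : IsEventualShift (pairZPow T T' μ) (μ • s) := by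
  obtain ⟨n, rfl | rfl⟩ := μ.eq_nat_or_neg
  · rw [pairZPow_natCast, natCast_zsmul]; exact h.pow n
  · rw [pairZPow_neg_natCast, neg_smul, natCast_zsmul, ← smul_neg]; exact h'.pow n

end IsEventualShift

/-- Distinct shifts send a point mass to distinct points, so a linear relation splits by `i`. For
fixed `i` it says that a polynomial with the given coefficients vanishes at `r^n` for all large `n`,
and these are infinitely many points. -/
theorem linearIndependent_pow_mul_of_isEventualShift {r : ℝ} (hr0 : 0 < r) (hr1 : r < 1)
    {ι : Type*} (T : ι → Module.End ℂ (ℤ × ℤ → ℂ)) (s : ι → ℤ × ℤ) (hs : Function.Injective s)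
    (hT : ∀ i, IsEventualShift (T i) (s i)) :
    LinearIndependent ℂ
      (fun x : ℕ × ι => weightedShift (fun n => (r : ℂ) ^ n) 0 0 ^ x.1 * T x.2) := by
  classical
  have hr : (r : ℂ) ≠ 0 := by exact_mod_cast hr0.ne'
  choose c hc hTc using hT
  rw [linearIndependent_iff]
  intro g hg
  ext ⟨k₀, i₀⟩
  let P : Polynomial ℂ := ∑ x ∈ g.support with x.2 = i₀,
    Polynomial.C (g x) * Polynomial.X ^ x.1
  have hcoeff : P.coeff k₀ = g (k₀, i₀) := by
    rw [Polynomial.finsetSum_coeff, Finset.sum_filter]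
    simp only [Polynomial.coeff_C_mul, Polynomial.coeff_X_pow, mul_ite, mul_one, mul_zero]
    rw [Finset.sum_eq_single (k₀, i₀)]
    · simp
    · rintro ⟨k, i⟩ _ hne
      split_ifs with h1 h2
      · exact absurd (Prod.ext h2.symm h1) hne
      · rfl
      · rfl
    · intro h; simpa using h
  have hroot : ∀ n : ℤ, c i₀ n ≠ 0 → P.eval ((r : ℂ) ^ n) = 0 := by
    intro n hn
    -- Starting from the mass at `(n, 0) - s i₀`, only the shift by `s i₀` reaches `(n, 0)`.
    have h1 := congrFun (LinearMap.congr_fun hg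
      (Pi.single (n - (s i₀).1, 0 - (s i₀).2) 1)) (n, 0)
    rw [Finsupp.linearCombination_apply, Finsupp.sum, LinearMap.sum_apply, Finset.sum_apply] at h1
    have h2 : ∀ x : ℕ × ι, (g x • (weightedShift (fun n => (r : ℂ) ^ n) 0 0 ^ x.1 * T x.2))
        (Pi.single (n - (s i₀).1, 0 - (s i₀).2) 1) (n, 0) =
        c i₀ n * if x.2 = i₀ then g x * ((r : ℂ) ^ n) ^ x.1 else 0 := by
      rintro ⟨k, i⟩
      rw [weightedShift_pow, hTc, weightedShift_mul]
      by_cases hi : i = i₀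
      · subst hi
        have : ((r : ℂ) ^ k) ^ n = ((r : ℂ) ^ n) ^ k := by
          rw [← zpow_natCast, ← zpow_natCast, zpow_comm]
        simp [this]; ring
      · have hne : (n - (s i).1, 0 - (s i).2) ≠ (n - (s i₀).1, 0 - (s i₀).2) := by
          intro he
          apply hi
          apply hs
          rw [Prod.mk.injEq] at he
          exact Prod.ext (by linarith [he.1]) (by linarith [he.2])
        simp only [LinearMap.smul_apply, Pi.smul_apply, weightedShift_apply, zero_add]
        rw [Pi.single_eq_of_ne hne]
        simp [hi]
    rw [Finset.sum_congr rfl fun x _ => h2 x, ← Finset.mul_sum, ← Finset.sum_filter] at h1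
    have h3 := (mul_eq_zero.mp h1).resolve_left hn
    simpa [P, Polynomial.eval_finsetSum] using h3
  have hP : P = 0 := by
    refine Polynomial.eq_zero_of_infinite_isRoot _ ?_
    obtain ⟨M, hM⟩ := Filter.eventually_atTop.mp (hc i₀)
    refine Set.infinite_of_injective_forall_mem (f := fun m : ℕ => (r : ℂ) ^ (M + m : ℤ)) ?_
      (fun m => hroot _ (hM _ (by omega)))
    intro m m' hmm
    have h4 : r ^ (M + m : ℤ) = r ^ (M + m' : ℤ) := by
      apply Complex.ofReal_injective
      push_cast
      exact hmm
    have := zpow_right_injective₀ hr0 hr1.ne h4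
    omega
  rw [← hcoeff, hP]; simp

theorem eventually_one_sub_zpow_ne_zero {r : ℝ} (hr0 : 0 < r) (hr1 : r < 1) :
    ∀ᶠ n : ℤ in Filter.atTop, 1 - (r : ℂ) ^ (n + 1) ≠ 0 := by
  filter_upwards [Filter.eventually_ge_atTop 0] with n hn h
  have h1 : r ^ (n + 1) = 1 := by exact_mod_cast (sub_eq_zero.mp h).symm
  exact (zpow_lt_one₀ hr0 hr1 (by omega)).ne h1

/-- Weighted shifts which satisfy the relations of the quantum disc and of a unitary which commutes
with it up to `e^{iπt}`. -/
theorem exists_isEventualShift {r : ℝ} (hr0 : 0 < r) (hr1 : r < 1) (t : ℝ) :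
    ∃ S S' U U' : Module.End ℂ (ℤ × ℤ → ℂ),
      (IsEventualShift S (1, 0) ∧ IsEventualShift S' (-1, 0) ∧
        IsEventualShift U (0, 1) ∧ IsEventualShift U' (0, -1)) ∧
      U * S = phase t • (S * U) ∧ U * S' = phase (-t) • (S' * U) ∧
      U' * S = phase (-t) • (S * U') ∧ U' * S' = phase t • (S' * U') ∧
      U * U' = 1 ∧ U' * U = 1 ∧ 1 - S * S' = weightedShift (fun n => (r : ℂ) ^ n) 0 0 ∧
      S' * S - (r : ℂ) • (S * S') = algebraMap ℂ _ (1 - r) := by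
  have hr : (r : ℂ) ≠ 0 := by exact_mod_cast hr0.ne'
  have ht := phase_ne_zero t
  -- No adjointness is needed, so `S` is the bare shift and `S'` carries the whole weight: `SS'` is
  -- multiplication by `1 - r^n` and `S'S` by `1 - r^{n+1}`. The weight of `S'` vanishes at `n =
  -- -1`, hence only eventual nonvanishing.
  refine ⟨weightedShift 1 1 0, weightedShift (fun n => 1 - (r : ℂ) ^ (n + 1)) (-1) 0,
    weightedShift (fun n => phase t ^ n) 0 1, weightedShift (fun n => (phase t ^ n)⁻¹) 0 (-1),
    ⟨⟨_, by simp, rfl⟩, ⟨_, eventually_one_sub_zpow_ne_zero hr0 hr1, rfl⟩,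
      ⟨_, .of_forall fun n => zpow_ne_zero _ ht, rfl⟩,
      ⟨_, .of_forall fun n => inv_ne_zero (zpow_ne_zero _ ht), rfl⟩⟩, ?_⟩
  simp only [weightedShift_mul, weightedShift_smul, one_eq_weightedShift,
    algebraMap_eq_weightedShift, phase_neg, add_zero, zero_add, neg_add_cancel, add_neg_cancel,
    weightedShift_sub]
  refine ⟨?_, ?_, ?_, ?_, ?_, ?_, ?_, ?_⟩ <;> congr 1 <;> funext n <;>
    simp only [sub_zero, sub_neg_eq_add, sub_add_cancel, zpow_sub₀ ht, zpow_add₀ ht, zpow_add₀ hr,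
      Pi.one_apply, zpow_one] <;>
    field_simp <;> ring

/-! ### Two representations and linear independence in the sphere. -/

section Sphere

variable {p q θ : ℝ} {N : ℕ}

/-- The representation of the Heegaard quantum sphere in which `a` is unitary. -/
theorem exists_rep_a_unitary (p : ℝ) (hq0 : 0 < q) (hq1 : q < 1) (θ : ℝ) :
    ∃ π : Sphere p q θ →ₐ[ℂ] Module.End ℂ (ℤ × ℤ → ℂ),
      π (1 - Sphere.a p q θ * star (Sphere.a p q θ)) = 0 ∧
      π (1 - Sphere.b p q θ * star (Sphere.b p q θ)) = weightedShift (fun n => (q : ℂ) ^ n) 0 0 ∧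
      IsEventualShift (π (Sphere.a p q θ)) (0, 1) ∧
      IsEventualShift (π (star (Sphere.a p q θ))) (0, -1) ∧
      IsEventualShift (π (Sphere.b p q θ)) (1, 0) ∧
      IsEventualShift (π (star (Sphere.b p q θ))) (-1, 0) := by
  obtain ⟨S, S', U, U', ⟨hS, hS', hU, hU'⟩, h1, h2, h3, h4, h5, h6, h7, h8⟩ :=
    exists_isEventualShift hq0 hq1 (2 * θ)
  obtain ⟨π, ha, ha', hb, hb'⟩ := exists_algHom_sphere (p := p) (q := q) (θ := θ) U U' S S' h1 h2
    (qcomm_inv (SphereRel.phase_cancel _) h4) (qcomm_inv (phase_mul_phase_neg _) h3)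
    (by rw [h5, h6, map_sub, map_one, Algebra.algebraMap_eq_smul_one]) h8
    (by rw [h5, sub_self, zero_mul]) (by rw [h5, sub_self, mul_zero])
  refine ⟨π, ?_, ?_, ?_, ?_, ?_, ?_⟩
  · rw [map_sub, map_mul, map_one, ha, ha', h5, sub_self]
  · rw [map_sub, map_mul, map_one, hb, hb', h7]
  · rwa [ha]
  · rwa [ha']
  · rwa [hb]
  · rw [hb']; assumption

/-- The representation of the Heegaard quantum sphere in which `b` is unitary. -/
theorem exists_rep_b_unitary (hp0 : 0 < p) (hp1 : p < 1) (q θ : ℝ) :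
    ∃ π : Sphere p q θ →ₐ[ℂ] Module.End ℂ (ℤ × ℤ → ℂ),
      π (1 - Sphere.a p q θ * star (Sphere.a p q θ)) = weightedShift (fun n => (p : ℂ) ^ n) 0 0 ∧
      IsEventualShift (π (Sphere.a p q θ)) (1, 0) ∧
      IsEventualShift (π (star (Sphere.a p q θ))) (-1, 0) ∧
      IsEventualShift (π (Sphere.b p q θ)) (0, 1) ∧
      IsEventualShift (π (star (Sphere.b p q θ))) (0, -1) := by
  -- Now `b` is the unitary and `a` the shift, so `ab = e^{2πiθ} ba` is read backwards and the phase
  -- changes sign.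
  obtain ⟨S, S', U, U', ⟨hS, hS', hU, hU'⟩, h1, h2, h3, h4, h5, h6, h7, h8⟩ :=
    exists_isEventualShift hp0 hp1 (-(2 * θ))
  rw [neg_neg] at h2 h3
  obtain ⟨π, ha, ha', hb, hb'⟩ := exists_algHom_sphere (p := p) (q := q) (θ := θ) S S' U U'
    (qcomm_inv (phase_mul_phase_neg _) h1) (qcomm_inv (SphereRel.phase_cancel _) h3)
    h4 h2 h8 (by rw [h5, h6, map_sub, map_one, Algebra.algebraMap_eq_smul_one])
    (by rw [h5, sub_self, mul_zero]) (by rw [h5, sub_self, zero_mul])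
  refine ⟨π, ?_, ?_, ?_, ?_, ?_⟩
  · rw [map_sub, map_mul, map_one, ha, ha', h7]
  · rwa [ha]
  · rwa [ha']
  · rwa [hb]
  · rw [hb']; assumption

/-- The vectors of the lens space, inside the Heegaard quantum sphere. -/
def sphereLensVector (p q θ : ℝ) (N : ℕ) : (ℕ+ × ℤ × ℤ) ⊕ (ℕ × ℤ × ℤ) → Sphere p q θ :=
  lensVector (Sphere.a p q θ ^ N) (Sphere.b p q θ ^ N) (Sphere.a p q θ * star (Sphere.b p q θ))
    (1 - Sphere.a p q θ * star (Sphere.a p q θ)) (1 - Sphere.b p q θ * star (Sphere.b p q θ))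

/-- A triangular argument: the representation with `a` unitary kills every vector containing `A` and
is injective on the span of the others, while the one with `b` unitary separates the vectors
containing `A`. -/
theorem linearIndependent_sphereLensVector (hp0 : 0 < p) (hp1 : p < 1) (hq0 : 0 < q) (hq1 : q < 1)
    (hN : 0 < N) : LinearIndependent ℂ (sphereLensVector p q θ N) := by
  have hN' : (N : ℤ) ≠ 0 := by exact_mod_cast hN.ne'
  obtain ⟨π, hA, hB, ha, ha', hb, hb'⟩ := exists_rep_a_unitary p hq0 hq1 θ
  have hr : LinearIndependent ℂ (π.toLinearMap ∘ (sphereLensVector p q θ N ∘ Sum.inr)) := by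
    have key := linearIndependent_pow_mul_of_isEventualShift hq0 hq1
      (fun i : ℤ × ℤ => pairZPow (π (Sphere.a p q θ * star (Sphere.b p q θ)))
          (π (star (Sphere.a p q θ * star (Sphere.b p q θ)))) i.1 *
        pairZPow (π (Sphere.a p q θ ^ N)) (π (star (Sphere.a p q θ ^ N))) i.2)
      -- `z = ab*` shifts by `(0, 1) + (-1, 0)` and `a^N` by `(0, N)`; these are independent because
      -- `N ≠ 0`.
      (fun i => i.1 • (-1, 1) + i.2 • (0, (N : ℤ)))
      (by
        rintro ⟨μ, ν⟩ ⟨μ', ν'⟩ h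
        simp only [Prod.smul_mk, Prod.mk_add_mk, Prod.mk.injEq, smul_eq_mul] at h
        have h1 : μ = μ' := by linarith [h.1]
        subst h1
        exact Prod.ext rfl (mul_right_cancel₀ hN' (by linarith [h.2])))
      (fun i => by
        refine .mul (.pairZPow ?_ ?_ _) (.pairZPow ?_ ?_ _)
        · rw [map_mul]; exact ha.mul hb'
        · rw [star_mul, star_star, map_mul]; exact hb.mul ha'
        · rw [map_pow]; simpa using ha.pow N
        · rw [star_pow, map_pow]; simpa using ha'.pow N)
    convert key using 1
    funext ⟨k, μ, ν⟩
    simp only [Function.comp_apply, sphereLensVector, lensVector, AlgHom.toLinearMap_apply]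
    rw [map_mul, map_mul, map_pow, hB, starZPow_eq_pairZPow, starZPow_eq_pairZPow, map_pairZPow,
      map_pairZPow, mul_assoc]
  have hl : LinearIndependent ℂ (sphereLensVector p q θ N ∘ Sum.inl) := by
    obtain ⟨ρ, hA, ha, ha', hb, hb'⟩ := exists_rep_b_unitary hp0 hp1 q θ
    have key := linearIndependent_pow_mul_of_isEventualShift hp0 hp1
      (fun i : ℤ × ℤ => pairZPow (ρ (Sphere.a p q θ * star (Sphere.b p q θ)))
          (ρ (star (Sphere.a p q θ * star (Sphere.b p q θ)))) i.1 *
        pairZPow (ρ (Sphere.b p q θ ^ N)) (ρ (star (Sphere.b p q θ ^ N))) i.2)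
      (fun i => i.1 • (1, -1) + i.2 • (0, (N : ℤ)))
      (by
        rintro ⟨μ, ν⟩ ⟨μ', ν'⟩ h
        simp only [Prod.smul_mk, Prod.mk_add_mk, Prod.mk.injEq, smul_eq_mul] at h
        have h1 : μ = μ' := by linarith [h.1]
        subst h1
        exact Prod.ext rfl (mul_right_cancel₀ hN' (by linarith [h.2])))
      (fun i => by
        refine .mul (.pairZPow ?_ ?_ _) (.pairZPow ?_ ?_ _)
        · rw [map_mul]; exact ha.mul hb'
        · rw [star_mul, star_star, map_mul]; exact hb.mul ha'
        · rw [map_pow]; simpa using hb.pow N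
        · rw [star_pow, map_pow]; simpa using hb'.pow N)
    suffices hc : LinearIndependent ℂ (ρ.toLinearMap ∘ (sphereLensVector p q θ N ∘ Sum.inl)) from
      hc.of_comp
    have hinj : Function.Injective fun x : ℕ+ × ℤ × ℤ => ((x.1 : ℕ), x.2) := by
      rintro ⟨k, i⟩ ⟨k', i'⟩ h
      rw [Prod.mk.injEq] at h
      exact Prod.ext (PNat.coe_injective h.1) h.2
    convert key.comp _ hinj using 1
    funext ⟨k, μ, ν⟩
    simp only [Function.comp_apply, sphereLensVector, lensVector, AlgHom.toLinearMap_apply]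
    rw [map_mul, map_mul, map_pow, hA, starZPow_eq_pairZPow, starZPow_eq_pairZPow, map_pairZPow,
      map_pairZPow, mul_assoc]
  rw [← Sum.elim_comp_inl_inr (sphereLensVector p q θ N)]
  refine hl.sum_type hr.of_comp ?_
  refine Disjoint.mono_left ?_ (Submodule.range_ker_disjoint hr).symm
  rw [Submodule.span_le]
  rintro _ ⟨⟨k, μ, ν⟩, rfl⟩
  simp only [Function.comp_apply, sphereLensVector, lensVector, SetLike.mem_coe, LinearMap.mem_ker,
    AlgHom.toLinearMap_apply]
  rw [map_mul, map_mul, map_pow, hA, zero_pow k.ne_zero, zero_mul, zero_mul]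

end Sphere

/-! ### Generators of universal *-algebras -/

theorem UniversalStarAlgebra.subalgebra_eq_top {X : Type}
    {r : FreeStarAlgebra X → FreeStarAlgebra X → Prop}
    (T : Subalgebra ℂ (UniversalStarAlgebra X r)) (h : ∀ x, gen x ∈ T)
    (h' : ∀ x, star (gen x) ∈ T) : T = ⊤ := by
  rw [eq_top_iff]
  intro y _
  obtain ⟨y, rfl⟩ := mk_surjective y
  induction y using FreeStarAlgebra.induction with
  | scalar c =>
    rw [AlgHomClass.commutes]; exact T.algebraMap_mem c
  | letter y =>
    cases y with
    | inl x => exact h x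
    | inr x =>
      have := h' x
      rw [gen, ← map_star, FreeStarAlgebra.gen, FreeStarAlgebra.star_letter] at this
      exact this
  | mul a b ha hb => rw [map_mul]; exact T.mul_mem (ha trivial) (hb trivial)
  | add a b ha hb => rw [map_add]; exact T.add_mem (ha trivial) (hb trivial)

/-! ### Transport of the lens relations along *-homomorphisms. -/

section LensRelMap

variable {p q θ : ℝ} {N : ℕ} {R S : Type*} [Ring R] [StarRing R] [Algebra ℂ R]
  [Ring S] [StarRing S] [Algebra ℂ S] (φ : R →⋆ₐ[ℂ] S)

theorem map_starZPow (x : R) (μ : ℤ) : φ (starZPow x μ) = starZPow (φ x) μ := by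
  rw [starZPow_eq_pairZPow, map_pairZPow, map_star, starZPow_eq_pairZPow]

theorem starAlgHom_map_qEval (s : ℝ) (μ : ℤ) (x : R) : φ (qEval s μ x) = qEval s μ (φ x) :=
  map_qEval φ.toAlgHom s μ x

theorem LensRel.map {a b z A B x y : R} (h : LensRel p q θ N a b z A B x y) :
    LensRel p q θ N (φ a) (φ b) (φ z) (φ A) (φ B) (φ x) (φ y) := by
  cases h <;> simp only [map_mul, map_smul, map_star, map_sub, map_add, map_one, map_zero, map_pow,
    map_starZPow, starAlgHom_map_qEval] <;> constructor

/-- Applied to the quotient map from the free *-algebra: a relation between the universal generators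
comes from a defining relation, which the quotient imposes. -/
theorem LensRel.exists_of_map {a b z A B : R} {x y : S}
    (h : LensRel p q θ N (φ a) (φ b) (φ z) (φ A) (φ B) x y) :
    ∃ x' y', LensRel p q θ N a b z A B x' y' ∧ φ x' = x ∧ φ y' = y := by
  cases h
  case star_A => exact ⟨_, _, .star_A, map_star _ _, rfl⟩
  case star_B => exact ⟨_, _, .star_B, map_star _ _, rfl⟩
  case AB => exact ⟨_, _, .AB, map_mul _ _ _, map_zero _⟩
  case Az => exact ⟨_, _, .Az, by simp only [map_mul], by simp only [map_mul, map_smul]⟩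
  case zB => exact ⟨_, _, .zB, by simp only [map_mul], by simp only [map_mul, map_smul]⟩
  case star_z_z => exact ⟨_, _, .star_z_z, by simp only [map_mul, map_star],
    by simp only [map_sub, map_smul, map_one]⟩
  case z_star_z => exact ⟨_, _, .z_star_z, by simp only [map_mul, map_star],
    by simp only [map_sub, map_smul, map_one]⟩
  case Aa => exact ⟨_, _, .Aa, by simp only [map_mul], by simp only [map_mul, map_smul]⟩
  case Ab => exact ⟨_, _, .Ab, by simp only [map_mul], by simp only [map_mul]⟩
  case Ba => exact ⟨_, _, .Ba, by simp only [map_mul], by simp only [map_mul]⟩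
  case Bb => exact ⟨_, _, .Bb, by simp only [map_mul], by simp only [map_mul, map_smul]⟩
  case za => exact ⟨_, _, .za, by simp only [map_mul], by simp only [map_mul, map_smul]⟩
  case zb_star => exact ⟨_, _, .zb_star, by simp only [map_mul, map_star],
    by simp only [map_mul, map_smul, map_star]⟩
  case za_star => exact ⟨_, _, .za_star, by simp only [map_sub, map_mul, map_smul, map_star],
    by simp only [map_mul, map_smul, map_star, map_starZPow]⟩
  case zb => exact ⟨_, _, .zb, by simp only [map_sub, map_mul, map_smul],
    by simp only [map_mul, map_smul, map_starZPow]⟩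
  case ab => exact ⟨_, _, .ab, by simp only [map_mul], by simp only [map_mul, map_smul]⟩
  case ab_star => exact ⟨_, _, .ab_star, by simp only [map_mul, map_star],
    by simp only [map_mul, map_smul, map_star]⟩
  case ab_star_eq => exact ⟨_, _, .ab_star_eq, by simp only [map_mul, map_star],
    by simp only [map_smul, map_pow]⟩
  case star_a_a => exact ⟨_, _, .star_a_a, by simp only [map_mul, map_star],
    by simp only [map_add, map_one, starAlgHom_map_qEval]⟩
  case a_star_a => exact ⟨_, _, .a_star_a, by simp only [map_mul, map_star],
    by simp only [map_add, map_one, starAlgHom_map_qEval]⟩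
  case star_b_b => exact ⟨_, _, .star_b_b, by simp only [map_mul, map_star],
    by simp only [map_add, map_one, starAlgHom_map_qEval]⟩
  case b_star_b => exact ⟨_, _, .b_star_b, by simp only [map_mul, map_star],
    by simp only [map_add, map_one, starAlgHom_map_qEval]⟩

end LensRelMap

/-! ### Spanning in the universal algebra and in the sphere. -/

section Universal

variable {p q θ : ℝ} {N : ℕ}

theorem lensGen_relations {x y : LensUniversal p q θ N}
    (h : LensRel p q θ N (lensGen p q θ N .a) (lensGen p q θ N .b) (lensGen p q θ N .z)
      (lensGen p q θ N .A) (lensGen p q θ N .B) x y) : x = y := by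
  obtain ⟨x, y, h', rfl, rfl⟩ := LensRel.exists_of_map UniversalStarAlgebra.mk h
  exact UniversalStarAlgebra.mk_rel h'

theorem lensBasisVector_eq_lensVector : lensBasisVector p q θ N =
    lensVector (lensGen p q θ N .a) (lensGen p q θ N .b) (lensGen p q θ N .z)
      (lensGen p q θ N .A) (lensGen p q θ N .B) := by
  funext i
  rcases i with ⟨k, μ, ν⟩ | ⟨k, μ, ν⟩ <;> rfl

theorem span_lensBasisVector (hp0 : 0 < p) (hq0 : 0 < q) :
    Submodule.span ℂ (Set.range (lensBasisVector p q θ N)) = ⊤ := by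
  rw [lensBasisVector_eq_lensVector]
  refine LensRel.span_lensVector (fun _ _ => lensGen_relations) ?_ hp0 hq0
  refine UniversalStarAlgebra.subalgebra_eq_top _ (fun x => ?_) (fun x => ?_)
  · refine Algebra.subset_adjoin ?_
    cases x <;> simp [lensGen]
  · cases x
    case A =>
      have : star (lensGen p q θ N .A) = lensGen p q θ N .A := lensGen_relations .star_A
      refine Algebra.subset_adjoin ?_
      change star (lensGen p q θ N .A) ∈ _
      rw [this]; simp
    case B =>
      have : star (lensGen p q θ N .B) = lensGen p q θ N .B := lensGen_relations .star_B
      refine Algebra.subset_adjoin ?_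
      change star (lensGen p q θ N .B) ∈ _
      rw [this]; simp
    all_goals exact Algebra.subset_adjoin (by simp [lensGen])

theorem sphereLensVector_relations (hp0 : 0 < p) (hq0 : 0 < q) (hN : 0 < N) {x y : Sphere p q θ}
    (h : LensRel p q θ N (Sphere.a p q θ ^ N) (Sphere.b p q θ ^ N)
      (Sphere.a p q θ * star (Sphere.b p q θ)) (1 - Sphere.a p q θ * star (Sphere.a p q θ))
      (1 - Sphere.b p q θ * star (Sphere.b p q θ)) x y) : x = y :=
  SphereRel.lensRel (fun _ _ => Sphere.relations p q θ) rfl rfl hp0 hq0 hN h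

/-- For `N = 1` the elements `ã, b̃` are `a, b` themselves, so the abstract spanning theorem yields
normal forms for the whole sphere. -/
theorem span_sphereLensVector_one (hp0 : 0 < p) (hq0 : 0 < q) :
    Submodule.span ℂ (Set.range (sphereLensVector p q θ 1)) = ⊤ := by
  refine LensRel.span_lensVector
    (fun _ _ => sphereLensVector_relations hp0 hq0 one_pos) ?_ hp0 hq0
  refine UniversalStarAlgebra.subalgebra_eq_top _ (fun x => Algebra.subset_adjoin ?_)
    (fun x => Algebra.subset_adjoin ?_)
  · cases x <;> simp [Sphere.a, Sphere.b]
  · cases x <;> simp [Sphere.a, Sphere.b]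

end Universal

/-! ### The lens algebra inside the sphere -/

section Lens

variable {p q θ : ℝ} {N : ℕ}

theorem coaction_a : coaction p q θ N (Sphere.a p q θ) = Sphere.a p q θ ⊗ₜ[ℂ] Cyclic.u N :=
  UniversalStarAlgebra.lift_gen _ _ _

theorem coaction_b : coaction p q θ N (Sphere.b p q θ) = Sphere.b p q θ ⊗ₜ[ℂ] Cyclic.u N :=
  UniversalStarAlgebra.lift_gen _ _ _

theorem Cyclic.u_pow (N : ℕ) : Cyclic.u N ^ N = 1 := by
  have h : (UniversalStarAlgebra.mk (FreeStarAlgebra.gen () ^ N) : Cyclic N) =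
      UniversalStarAlgebra.mk 1 := UniversalStarAlgebra.mk_rel .pow
  rw [map_pow, map_one] at h; exact h

/-- The value at `x` of the lens space generators inside the sphere. -/
def sphereLensGen (p q θ : ℝ) (N : ℕ) : LensGen → Sphere p q θ
  | .a => Sphere.a p q θ ^ N
  | .b => Sphere.b p q θ ^ N
  | .z => Sphere.a p q θ * star (Sphere.b p q θ)
  | .A => 1 - Sphere.a p q θ * star (Sphere.a p q θ)
  | .B => 1 - Sphere.b p q θ * star (Sphere.b p q θ)

theorem sphereLensGen_mem (x : LensGen) : sphereLensGen p q θ N x ∈ lensAlgebra p q θ N := by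
  change coaction p q θ N _ = _ ⊗ₜ[ℂ] 1
  cases x with
  | a => rw [sphereLensGen, map_pow, coaction_a, Algebra.TensorProduct.tmul_pow, Cyclic.u_pow]
  | b => rw [sphereLensGen, map_pow, coaction_b, Algebra.TensorProduct.tmul_pow, Cyclic.u_pow]
  | z => rw [sphereLensGen, map_mul, map_star, coaction_a, coaction_b, TensorProduct.star_tmul,
      Algebra.TensorProduct.tmul_mul_tmul, Cyclic.u_mul_star_u]
  | A => rw [sphereLensGen, map_sub, map_mul, map_star, map_one, coaction_a,
      TensorProduct.star_tmul, Algebra.TensorProduct.tmul_mul_tmul, Cyclic.u_mul_star_u,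
      TensorProduct.sub_tmul, Algebra.TensorProduct.one_def]
  | B => rw [sphereLensGen, map_sub, map_mul, map_star, map_one, coaction_b,
      TensorProduct.star_tmul, Algebra.TensorProduct.tmul_mul_tmul, Cyclic.u_mul_star_u,
      TensorProduct.sub_tmul, Algebra.TensorProduct.one_def]

/-- The *-homomorphism from the universal algebra of the lens space relations. -/
theorem exists_lensHom (hp0 : 0 < p) (hq0 : 0 < q) (hN : 0 < N) :
    ∃ φ : LensUniversal p q θ N →⋆ₐ[ℂ] lensAlgebra p q θ N,
      ∀ x, (φ (lensGen p q θ N x) : Sphere p q θ) = sphereLensGen p q θ N x := by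
  let f : LensGen → lensAlgebra p q θ N := fun x => ⟨sphereLensGen p q θ N x, sphereLensGen_mem x⟩
  refine ⟨UniversalStarAlgebra.lift f fun x y h => ?_, fun x => ?_⟩
  · have h' := (h.map (FreeStarAlgebra.lift f)).map (lensAlgebra p q θ N).subtype
    simp only [FreeStarAlgebra.lift_gen] at h'
    exact Subtype.ext (sphereLensVector_relations hp0 hq0 hN h')
  · rw [lensGen, UniversalStarAlgebra.lift_gen]

/-- For an `N`-th root of unity `ζ` there is an endomorphism `a ↦ ζ a`, `b ↦ ζ b` of the sphere
which fixes the lens algebra. -/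
theorem exists_rotation (hN : 0 < N) {ζ : ℂ} (hζ : ζ ^ N = 1) :
    ∃ α : Sphere p q θ →ₐ[ℂ] Sphere p q θ,
      α (Sphere.a p q θ) = ζ • Sphere.a p q θ ∧
      α (star (Sphere.a p q θ)) = ζ⁻¹ • star (Sphere.a p q θ) ∧
      α (Sphere.b p q θ) = ζ • Sphere.b p q θ ∧
      α (star (Sphere.b p q θ)) = ζ⁻¹ • star (Sphere.b p q θ) ∧
      ∀ x ∈ lensAlgebra p q θ N, α x = x := by
  have hζ0 : ζ ≠ 0 := by
    rintro rfl
    rw [zero_pow hN.ne'] at hζ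
    exact zero_ne_one hζ
  have hζs : star ζ = ζ⁻¹ := by
    rw [Complex.inv_def, Complex.normSq_eq_norm_sq, Complex.norm_eq_one_of_pow_eq_one hζ hN.ne']
    simp
  -- The root of unity is a character `u ↦ ζ` of `O(ℤ/N)`; the rotation is the coaction followed by
  -- this character, hence fixes the invariants.
  let χ : Cyclic N →⋆ₐ[ℂ] ℂ := UniversalStarAlgebra.lift (fun _ => ζ) (by
    intro x y h
    cases h with
    | star_mul => simp [FreeStarAlgebra.lift_gen, map_star, hζs, hζ0, -Complex.star_def]
    | mul_star => simp [FreeStarAlgebra.lift_gen, map_star, hζs, hζ0, -Complex.star_def]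
    | pow => rw [map_pow, FreeStarAlgebra.lift_gen, hζ, map_one])
  have hχ : χ (Cyclic.u N) = ζ := UniversalStarAlgebra.lift_gen _ _ _
  let α : Sphere p q θ →ₐ[ℂ] Sphere p q θ :=
    ((Algebra.TensorProduct.rid ℂ ℂ (Sphere p q θ)).toAlgHom.comp
      (Algebra.TensorProduct.map (AlgHom.id ℂ _) χ.toAlgHom)).comp (coaction p q θ N).toAlgHom
  have hα : ∀ x y c, coaction p q θ N x = y ⊗ₜ[ℂ] c → α x = χ c • y := by
    intro x y c h
    change Algebra.TensorProduct.rid ℂ ℂ (Sphere p q θ)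
      (Algebra.TensorProduct.map (AlgHom.id ℂ _) χ.toAlgHom (coaction p q θ N x)) = _
    rw [h, Algebra.TensorProduct.map_tmul, Algebra.TensorProduct.rid_tmul]
    rfl
  refine ⟨α, ?_, ?_, ?_, ?_, fun x hx => ?_⟩
  · rw [hα _ _ _ coaction_a, hχ]
  · rw [hα _ (star (Sphere.a p q θ)) (star (Cyclic.u N)), map_star, hχ, hζs]
    rw [map_star, coaction_a, TensorProduct.star_tmul]
  · rw [hα _ _ _ coaction_b, hχ]
  · rw [hα _ (star (Sphere.b p q θ)) (star (Cyclic.u N)), map_star, hχ, hζs]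
    rw [map_star, coaction_b, TensorProduct.star_tmul]
  · rw [hα x x 1 hx, map_one, one_smul]

theorem pairZPow_smul_inv {R : Type*} [Ring R] [Algebra ℂ R] (ζ : ℂ) (x y : R) (μ : ℤ) :
    pairZPow (ζ • x) (ζ⁻¹ • y) μ = ζ ^ μ • pairZPow x y μ := by
  obtain ⟨n, rfl | rfl⟩ := μ.eq_nat_or_neg
  · rw [pairZPow_natCast, pairZPow_natCast, smul_pow, zpow_natCast]
  · rw [pairZPow_neg_natCast, pairZPow_neg_natCast, smul_pow, zpow_neg, zpow_natCast, inv_pow]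

/-- The degree of the vectors of the sphere. -/
def sphereDegree : (ℕ+ × ℤ × ℤ) ⊕ (ℕ × ℤ × ℤ) → ℤ :=
  Sum.elim (fun i => i.2.2) (fun i => i.2.2)

/-- `z`, `A` and `B` have degree zero, so only the last factor `a^ν` or `b^ν` is rescaled. -/
theorem rotation_sphereLensVector_one {ζ : ℂ} (hζ : ζ ≠ 0) (α : Sphere p q θ →ₐ[ℂ] Sphere p q θ)
    (ha : α (Sphere.a p q θ) = ζ • Sphere.a p q θ)
    (ha' : α (star (Sphere.a p q θ)) = ζ⁻¹ • star (Sphere.a p q θ))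
    (hb : α (Sphere.b p q θ) = ζ • Sphere.b p q θ)
    (hb' : α (star (Sphere.b p q θ)) = ζ⁻¹ • star (Sphere.b p q θ)) (i) :
    α (sphereLensVector p q θ 1 i) = ζ ^ sphereDegree i • sphereLensVector p q θ 1 i := by
  have hz : α (Sphere.a p q θ * star (Sphere.b p q θ)) =
      Sphere.a p q θ * star (Sphere.b p q θ) := by
    rw [map_mul, ha, hb', smul_mul_smul_comm, mul_inv_cancel₀ hζ, one_smul]
  have hz' : α (star (Sphere.a p q θ * star (Sphere.b p q θ))) =
      star (Sphere.a p q θ * star (Sphere.b p q θ)) := by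
    rw [star_mul, star_star, map_mul, ha', hb, smul_mul_smul_comm, mul_inv_cancel₀ hζ, one_smul]
  have hA : α (1 - Sphere.a p q θ * star (Sphere.a p q θ)) =
      1 - Sphere.a p q θ * star (Sphere.a p q θ) := by
    rw [map_sub, map_one, map_mul, ha, ha', smul_mul_smul_comm, mul_inv_cancel₀ hζ, one_smul]
  have hB : α (1 - Sphere.b p q θ * star (Sphere.b p q θ)) =
      1 - Sphere.b p q θ * star (Sphere.b p q θ) := by
    rw [map_sub, map_one, map_mul, hb, hb', smul_mul_smul_comm, mul_inv_cancel₀ hζ, one_smul]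
  rcases i with ⟨k, μ, ν⟩ | ⟨k, μ, ν⟩
  · simp only [sphereLensVector, lensVector, sphereDegree, Sum.elim_inl, starZPow_eq_pairZPow,
      pow_one]
    rw [map_mul, map_mul, map_pow, map_pairZPow, map_pairZPow, hA, hz, hz', hb, hb',
      pairZPow_smul_inv, mul_smul_comm]
  · simp only [sphereLensVector, lensVector, sphereDegree, Sum.elim_inr, starZPow_eq_pairZPow,
      pow_one]
    rw [map_mul, map_mul, map_pow, map_pairZPow, map_pairZPow, hB, hz, hz', ha, ha',
      pairZPow_smul_inv, mul_smul_comm]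

theorem sphereLensVector_one_mem_range (i) (hi : (N : ℤ) ∣ sphereDegree i) :
    sphereLensVector p q θ 1 i ∈ Set.range (sphereLensVector p q θ N) := by
  rcases i with ⟨k, μ, ν⟩ | ⟨k, μ, ν⟩
  · obtain ⟨ν, rfl⟩ : (N : ℤ) ∣ ν := hi
    refine ⟨Sum.inl (k, μ, ν), ?_⟩
    simp only [sphereLensVector, lensVector, starZPow_eq_pairZPow, pow_one, star_pow,
      pairZPow_pow_natCast_mul]
  · obtain ⟨ν, rfl⟩ : (N : ℤ) ∣ ν := hi
    refine ⟨Sum.inr (k, μ, ν), ?_⟩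
    simp only [sphereLensVector, lensVector, starZPow_eq_pairZPow, pow_one, star_pow,
      pairZPow_pow_natCast_mul]

/-- The rotation is diagonal in the `N = 1` basis with eigenvalues `ζ^deg`. A fixed element has
nonzero coordinates only where `ζ^deg = 1`, which for primitive `ζ` means `N ∣ deg`. -/
theorem lensAlgebra_le_span (hp0 : 0 < p) (hp1 : p < 1) (hq0 : 0 < q) (hq1 : q < 1)
    (hN : 0 < N) {x : Sphere p q θ} (hx : x ∈ lensAlgebra p q θ N) :
    x ∈ Submodule.span ℂ (Set.range (sphereLensVector p q θ N)) := by
  have hζ := Complex.isPrimitiveRoot_exp N hN.ne'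
  set ζ := Complex.exp (2 * Real.pi * Complex.I / N)
  obtain ⟨α, ha, ha', hb, hb', hfix⟩ := exists_rotation (p := p) (q := q) (θ := θ) hN hζ.pow_eq_one
  have hrot := rotation_sphereLensVector_one (hζ.ne_zero hN.ne') α ha ha' hb hb'
  have hli := linearIndependent_sphereLensVector (θ := θ) hp0 hp1 hq0 hq1 one_pos
  let b := Module.Basis.mk hli (span_sphereLensVector_one hp0 hq0).ge
  have hb : ∀ i, b i = sphereLensVector p q θ 1 i := fun i => Module.Basis.mk_apply _ _ i
  have hcoord : ∀ y i, b.repr (α y) i = ζ ^ sphereDegree i * b.repr y i := by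
    intro y i
    have : (Finsupp.lapply i ∘ₗ b.repr.toLinearMap) ∘ₗ α.toLinearMap =
        ζ ^ sphereDegree i • (Finsupp.lapply i ∘ₗ b.repr.toLinearMap) := by
      refine b.ext fun j => ?_
      simp only [LinearMap.comp_apply, AlgHom.toLinearMap_apply, LinearMap.smul_apply, hb, hrot]
      simp only [← hb]
      by_cases hij : j = i
      · subst hij; simp
      · simp [hij]
    exact LinearMap.congr_fun this y
  rw [← b.linearCombination_repr x, Finsupp.linearCombination_apply]
  refine Submodule.sum_mem _ fun i hi => Submodule.smul_mem _ _ (Submodule.subset_span ?_)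
  rw [hb]
  refine sphereLensVector_one_mem_range i ((hζ.zpow_eq_one_iff_dvd _).mp ?_)
  have h1 := hcoord x i
  rw [hfix x hx] at h1
  exact (mul_eq_right₀ (Finsupp.mem_support_iff.mp hi)).mp h1.symm

end Lens

end HeegaardLens

end

open HeegaardLens
theorem mainTheorem3 (p q θ : ℝ) (N : ℕ) (hp0 : 0 < p) (hp1 : p < 1) (hq0 : 0 < q) (hq1 : q < 1)
    (hθ0 : 0 ≤ θ) (hθ1 : θ < 1) (hθ : Irrational θ) (hN : 0 < N) :
    (∃ f : LensUniversal p q θ N ≃⋆ₐ[ℂ] lensAlgebra p q θ N,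
      (f (lensGen p q θ N .a) : Sphere p q θ) = Sphere.a p q θ ^ N ∧
      (f (lensGen p q θ N .b) : Sphere p q θ) = Sphere.b p q θ ^ N ∧
      (f (lensGen p q θ N .z) : Sphere p q θ) = Sphere.a p q θ * star (Sphere.b p q θ) ∧
      (f (lensGen p q θ N .A) : Sphere p q θ) = 1 - Sphere.a p q θ * star (Sphere.a p q θ) ∧
      (f (lensGen p q θ N .B) : Sphere p q θ) = 1 - Sphere.b p q θ * star (Sphere.b p q θ)) ∧
    LinearIndependent ℂ (lensBasisVector p q θ N) ∧
    Submodule.span ℂ (Set.range (lensBasisVector p q θ N)) = ⊤ := by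
  obtain ⟨φ, hφ⟩ := exists_lensHom (p := p) (q := q) (θ := θ) hp0 hq0 hN
  let ψ : LensUniversal p q θ N →⋆ₐ[ℂ] Sphere p q θ := (lensAlgebra p q θ N).subtype.comp φ
  have hψ : ∀ x, ψ (lensGen p q θ N x) = sphereLensGen p q θ N x := hφ
  have hvec : ψ.toAlgHom.toLinearMap ∘ lensBasisVector p q θ N = sphereLensVector p q θ N := by
    funext i
    rcases i with ⟨k, μ, ν⟩ | ⟨k, μ, ν⟩
    · change ψ (_ ^ _ * _ * _) = _
      rw [map_mul, map_mul, map_pow, map_starZPow, map_starZPow, hψ, hψ, hψ]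
      rfl
    · change ψ (_ ^ _ * _ * _) = _
      rw [map_mul, map_mul, map_pow, map_starZPow, map_starZPow, hψ, hψ, hψ]
      rfl
  have hspan := span_lensBasisVector (p := p) (q := q) (θ := θ) (N := N) hp0 hq0
  have hli := linearIndependent_sphereLensVector (θ := θ) hp0 hp1 hq0 hq1 hN
  rw [← hvec] at hli
  -- The kernel of `ψ` is disjoint from the span of a family with independent image, and that span
  -- is everything.
  have hinj : Function.Injective ψ := by
    have hd := Submodule.range_ker_disjoint hli
    rw [hspan, top_disjoint] at hd
    exact LinearMap.ker_eq_bot.mp hd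
  have hbij : Function.Bijective φ := by
    refine ⟨fun x y h => hinj (congrArg Subtype.val h), fun x => ?_⟩
    have hx := lensAlgebra_le_span hp0 hp1 hq0 hq1 hN x.2
    -- The span of the sphere vectors is the image under `ψ` of the span of the universal ones, that
    -- is, the range of `ψ`.
    rw [← hvec, Set.range_comp, ← Submodule.map_span, hspan] at hx
    obtain ⟨y, -, hy⟩ := hx
    exact ⟨y, Subtype.ext hy⟩
  -- Independence of the indexed family includes that its vectors are pairwise distinct.
  exact ⟨⟨StarAlgEquiv.ofBijective φ hbij, hφ .a, hφ .b, hφ .z, hφ .A, hφ .B⟩, hli.of_comp, hspan⟩
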